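/- Let $\Omega\subset\mathbb{R}^d$ be a nonempty, bounded, uniform domain, i.e. an open connected set for which there is $K\ge 1$ such that any two points $x,y\in\Omega$ are joined by a curve $\gamma\colon[0,l]\to\Omega$ parametrized by arc length with $l\le K|x-y|$ and $\operatorname{dist}(z,\partial\Omega)\ge \frac1K\min\{|z-x|,|z-y|\}$ for every point $z$ of $\gamma$. Let $d_\Omega(x)=\operatorname{dist}(x,\partial\Omega)$, let $0<s<1$ and $0<\theta\le 1$, and let $w,v$ be weights on $\mathbb{R}^d$ in the Muckenhoupt class $A_1$: measurable functions, positive almost everywhere, such that for some constant $A>0$ every cube $Q\subset\mathbb{R}^d$ satisfies $\frac1{|Q|}\int_Q w\,dx\le A\operatorname*{ess\,inf}_{Q}w$, and similarly for $v$. Then there is a constant $C>0$, depending only on $\Omega,s,d,w,v$ and $\theta$, such that for all $f\in L^1_{loc}(\Omega)$ the full seminorm $$[f]_{W^{s,1;w,v}(\Omega)}=\int_\Omega\int_\Omega\frac{|f(x)-f(y)|}{|x-y|^{d+s}}\,w(y)v(x)\,dy\,dx\in[0,\infty]$$ and the truncated seminorm $$T(f)=\int_\Omega\int_{B(x,\theta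 d_\Omega(x))}\frac{|f(x)-f(y)|}{|x-y|^{d+s}}\bigl(w(x)v(y)+w(y)v(x)\bigr)\,dy\,dx\in[0,\infty]$$ are comparable: $$[f]_{W^{s,1;w,v}(\Omega)}\le C\,T(f)\qquad\text{and}\qquad T(f)\le C\,[f]_{W^{s,1;w,v}(\Omega)}.$$ -/

import Mathlib

open MeasureTheory Set
open scoped ENNReal

noncomputable section

/-- The distance `d_Ω(x) = dist(x, ∂Ω)`. -/
def boundaryDist {d : ℕ} (Ω : Set (EuclideanSpace ℝ (Fin d))) (x : EuclideanSpace ℝ (Fin d)) : ℝ :=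
  Metric.infDist x (frontier Ω)

/-- A uniform domain: an open connected set in which any two points `x, y` are joined by a curve
`γ : [0, l] → Ω`, parametrized by arc length, of length `l ≤ C |x - y|`, with
`dist(z, ∂Ω) ≥ min {|z - x|, |z - y|} / C` for every point `z` of the curve.
(The extended distance is used, so that the distance to an empty boundary is `∞`.) -/
def IsUniformDomain {d : ℕ} (Ω : Set (EuclideanSpace ℝ (Fin d))) : Prop :=
  IsOpen Ω ∧ IsConnected Ω ∧
    ∃ C : ℝ, 1 ≤ C ∧ ∀ x ∈ Ω, ∀ y ∈ Ω,
      ∃ (l : ℝ) (γ : ℝ → EuclideanSpace ℝ (Fin d)),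
        0 ≤ l ∧ MapsTo γ (Icc 0 l) Ω ∧ HasUnitSpeedOn γ (Icc 0 l) ∧ γ 0 = x ∧ γ l = y ∧
        l ≤ C * dist x y ∧
        ∀ t ∈ Icc 0 l,
          ENNReal.ofReal (min (dist (γ t) x) (dist (γ t) y) / C) ≤
            Metric.infEDist (γ t) (frontier Ω)

/-- The closed axis-parallel cube with lower corner `a` and side length `l`. -/
def cube {d : ℕ} (a : EuclideanSpace ℝ (Fin d)) (l : ℝ) : Set (EuclideanSpace ℝ (Fin d)) :=
  {x | ∀ i, a i ≤ x i ∧ x i ≤ a i + l}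

/-- The Muckenhoupt class `A₁` on `ℝᵈ`: (a.e.) positive weights whose mean over every cube is at
most a constant times their (essential) infimum over the cube. The mean is taken in `[0, ∞]`, and
the essential infimum of a real function over a cube is finite, so that the condition includes
local integrability. -/
def IsMuckenhouptA1 {d : ℕ} (w : EuclideanSpace ℝ (Fin d) → ℝ) : Prop :=
  AEMeasurable w volume ∧ (∀ᵐ x ∂volume, 0 < w x) ∧
    ∃ A : ℝ, 0 < A ∧ ∀ (a : EuclideanSpace ℝ (Fin d)) (l : ℝ), 0 < l →
      (∫⁻ x in cube a l, ENNReal.ofReal (w x)) / volume (cube a l) ≤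
        ENNReal.ofReal A *
          essInf (fun y => ENNReal.ofReal (w y)) (volume.restrict (cube a l))

/-- The weighted Gagliardo seminorm `[f]_{W^{s,p;w,v}(Ω)}`, with values in `[0, ∞]`. -/
def gagliardoSeminorm {d : ℕ} (s p : ℝ) (w v : EuclideanSpace ℝ (Fin d) → ℝ)
    (Ω : Set (EuclideanSpace ℝ (Fin d))) (f : EuclideanSpace ℝ (Fin d) → ℝ) : ℝ≥0∞ :=
  (∫⁻ x in Ω, ∫⁻ y in Ω,
    ENNReal.ofReal (|f x - f y| ^ p / dist x y ^ ((d : ℝ) + s * p) * (w y * v x))) ^ (1 / p)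

/-- The truncated seminorm for `p = 1`, with the symmetrized weight `w(x) v(y) + w(y) v(x)` and
`y` ranging over `B(x, θ d_Ω(x))`; values in `[0, ∞]`. -/
def truncatedSeminorm {d : ℕ} (s θ : ℝ) (w v : EuclideanSpace ℝ (Fin d) → ℝ)
    (Ω : Set (EuclideanSpace ℝ (Fin d))) (f : EuclideanSpace ℝ (Fin d) → ℝ) : ℝ≥0∞ :=
  ∫⁻ x in Ω, ∫⁻ y in Metric.ball x (θ * boundaryDist Ω x),
    ENNReal.ofReal (|f x - f y| / dist x y ^ ((d : ℝ) + s) * (w x * v y + w y * v x))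

end

open Filter Topology Metric

/-! The bound of `T` by the full seminorm holds because the balls `B(x, θ d_Ω(x))` lie in `Ω` and
the full seminorm is symmetric in the two weights. The other bound combines chaining with the `A₁`
condition.

Chaining: uniformity provides, near `x` and at each dyadic scale `t` up to about `|x - y|`, a point
at distance `t` from `x` and at distance at least `t / K` from the boundary. Averages of `f` over
small balls at these points tend to `f x` for almost every `x`, and neighbouring averages are joined
by a chain of boundedly many balls inside `Ω`. Hence `|f x - f y|` is at most a constant times the
sum over dyadic `t ≤ |x - y|` of `t^(-2d) (O_t(x) + O_t(y))`, where `O_t(x)` integrates `|f z - f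
z'|` over `z ∈ B(x, M t)` of depth at least `c t` and `z' ∈ B(z, η t)`
(`HasUniformCurves.ae_edist_le`).

Weights: for the part with `O_t(x)`, the integral over `y` is the kernel tail `∫_{|x - y| ≥ t} |x -
y|^(-d-s) w(y) dy`, which by `A₁` is at most `C t^(-s) w(z')` for almost every `z'` within a
multiple of `t` of `x` (`exists_lintegral_tail_le`). By Fubini the integral over `x` becomes
`∫_{B(z, M t)} v ≤ C t^d v(z)` (`lintegral_mul_innerOsc_le`). What remains carries the factor
`t^(-d-s)`; summing over `t ≥ |z - z'| / η` recovers the kernel, and `η < θ c` forces `z' ∈ B(z, θ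
d_Ω(z))` (`exists_tsum_innerPart_le`). The part with `O_t(y)` is the same with the weights
exchanged, whence the symmetrized weight in `T`. -/

/-- The pointwise form of the `A₁` condition: over every ball centred at almost every `z`, the
integral of `W` is at most `A rᵈ W(z)`. -/
def IsPointwiseA1 {d : ℕ} (A : ℝ≥0∞) (W : EuclideanSpace ℝ (Fin d) → ℝ≥0∞) : Prop :=
  ∀ᵐ z ∂(volume : Measure (EuclideanSpace ℝ (Fin d))), ∀ r : ℝ, 0 < r →
    ∫⁻ x in closedBall z r, W x ≤ A * ENNReal.ofReal (r ^ d) * W z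

/-! ### The `A₁` condition at almost every point -/

section Weights

variable {d : ℕ}

theorem cube_eq_preimage (a : EuclideanSpace ℝ (Fin d)) (l : ℝ) :
    cube a l = (MeasurableEquiv.toLp 2 (Fin d → ℝ)).symm ⁻¹'
      Icc (fun i => a i) (fun i => a i + l) := by
  ext x
  simp only [cube, mem_ofPred_eq, mem_preimage, mem_Icc, Pi.le_def, forall_and]
  rfl

theorem measurableSet_cube (a : EuclideanSpace ℝ (Fin d)) (l : ℝ) :
    MeasurableSet (cube a l) := by
  rw [cube_eq_preimage]
  exact (MeasurableEquiv.measurable _) measurableSet_Icc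

theorem volume_cube (a : EuclideanSpace ℝ (Fin d)) {l : ℝ} (hl : 0 ≤ l) :
    volume (cube a l) = ENNReal.ofReal (l ^ d) := by
  rw [cube_eq_preimage, (EuclideanSpace.volume_preserving_symm_measurableEquiv_toLp
    (Fin d)).measure_preimage measurableSet_Icc.nullMeasurableSet, Real.volume_Icc_pi]
  simp [ENNReal.ofReal_pow hl]

/-- Reduces balls to countably many cubes, so that the exceptional null sets can be united. -/
theorem exists_rat_cube (z : EuclideanSpace ℝ (Fin d)) {r : ℝ} (hr : 0 < r) :
    ∃ (q : Fin d → ℚ) (l : ℚ), 0 < (l : ℝ) ∧ (l : ℝ) ≤ 4 * r ∧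
      closedBall z r ⊆ cube (WithLp.toLp 2 fun i => (q i : ℝ)) l := by
  have h : ∀ i, ∃ q : ℚ, z i - 2 * r < q ∧ (q : ℝ) < z i - r :=
    fun i => exists_rat_btwn (by linarith)
  choose q hq using h
  obtain ⟨l, hl1, hl2⟩ := exists_rat_btwn (show 3 * r < 4 * r by linarith)
  refine ⟨q, l, by linarith, hl2.le, fun x hx i => ?_⟩
  have h1 : |x i - z i| ≤ r := by
    have := PiLp.norm_apply_le (x - z) i
    rw [PiLp.sub_apply, Real.norm_eq_abs, ← dist_eq_norm] at this
    exact this.trans hx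
  have h2 := abs_le.1 h1
  have h3 := hq i
  constructor <;> simp only <;> linarith [h2.1, h2.2, h3.1, h3.2]

theorem IsPointwiseA1.congr {A : ℝ≥0∞} {W W' : EuclideanSpace ℝ (Fin d) → ℝ≥0∞}
    (h : IsPointwiseA1 A W) (hW : W =ᵐ[volume] W') : IsPointwiseA1 A W' := by
  filter_upwards [h, hW] with z hz hz' r hr
  rw [← hz', ← lintegral_congr_ae (ae_restrict_of_ae hW)]
  exact hz r hr

/-- The essential infimum over a cube bounds `w z` from below only off a null set depending on the
cube. With rational cubes one null set serves all radii; the side length at most `4 r` costs the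
factor `4 ^ d`. -/
theorem IsMuckenhouptA1.exists_isPointwiseA1 {w : EuclideanSpace ℝ (Fin d) → ℝ}
    (hw : IsMuckenhouptA1 w) :
    ∃ A : ℝ≥0∞, A ≠ ∞ ∧ IsPointwiseA1 A fun x => ENNReal.ofReal (w x) := by
  obtain ⟨-, -, A, hA, h⟩ := hw
  refine ⟨ENNReal.ofReal A * ENNReal.ofReal (4 ^ d),
    ENNReal.mul_ne_top ENNReal.ofReal_ne_top ENNReal.ofReal_ne_top, ?_⟩
  have key : ∀ᵐ z ∂(volume : Measure (EuclideanSpace ℝ (Fin d))), ∀ (q : Fin d → ℚ) (l : ℚ),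
      z ∈ cube (WithLp.toLp 2 fun i => (q i : ℝ)) (l : ℝ) →
      essInf (fun y => ENNReal.ofReal (w y))
        (volume.restrict (cube (WithLp.toLp 2 fun i => (q i : ℝ)) (l : ℝ))) ≤
        ENNReal.ofReal (w z) := by
    rw [ae_all_iff]; intro q
    rw [ae_all_iff]; intro l
    exact (ae_restrict_iff' (measurableSet_cube _ _)).1 ae_essInf_le
  filter_upwards [key] with z hz r hr
  obtain ⟨q, l, hl, hlr, hsub⟩ := exists_rat_cube z hr
  have h1 := h (WithLp.toLp 2 fun i => (q i : ℝ)) l hl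
  have hv := volume_cube (WithLp.toLp 2 fun i => (q i : ℝ)) hl.le
  have hpos : ENNReal.ofReal ((l : ℝ) ^ d) ≠ 0 := by
    simpa using pow_pos hl d
  rw [hv, ENNReal.div_le_iff hpos ENNReal.ofReal_ne_top] at h1
  calc ∫⁻ x in closedBall z r, ENNReal.ofReal (w x)
      ≤ _ := lintegral_mono_set hsub
    _ ≤ _ := h1
    _ ≤ ENNReal.ofReal A * ENNReal.ofReal (w z) * ENNReal.ofReal ((4 * r) ^ d) := by
      gcongr
      exact hz q l (hsub (mem_closedBall_self hr.le))
    _ = _ := by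
      rw [mul_pow, ENNReal.ofReal_mul (by positivity)]
      ring

end Weights

/-! ### Interior points and chains in uniform domains -/

section Geometry

variable {d : ℕ} {Ω : Set (EuclideanSpace ℝ (Fin d))}

/-- The property of a uniform domain that is used below: curves are Lipschitz and their points have
distance to the boundary bounded from below. -/
def HasUniformCurves (Ω : Set (EuclideanSpace ℝ (Fin d))) (K : ℝ) : Prop :=
  ∀ x ∈ Ω, ∀ y ∈ Ω, ∃ (l : ℝ) (γ : ℝ → EuclideanSpace ℝ (Fin d)),
    0 ≤ l ∧ MapsTo γ (Icc 0 l) Ω ∧ LipschitzOnWith 1 γ (Icc 0 l) ∧ γ 0 = x ∧ γ l = y ∧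
      l ≤ K * dist x y ∧
      ∀ t ∈ Icc 0 l, min (dist (γ t) x) (dist (γ t) y) / K ≤ boundaryDist Ω (γ t)

theorem HasUnitSpeedOn.lipschitzOnWith {E : Type*} [PseudoEMetricSpace E] {γ : ℝ → E} {s : Set ℝ}
    (h : HasUnitSpeedOn γ s) : LipschitzOnWith 1 γ s := by
  have key : ∀ x ∈ s, ∀ y ∈ s, x ≤ y → edist (γ x) (γ y) ≤ edist x y := by
    intro x hx y hy hxy
    have h1 := eVariationOn.edist_le γ (s := s ∩ Icc x y) (x := x) (y := y)
      ⟨hx, left_mem_Icc.2 hxy⟩ ⟨hy, right_mem_Icc.2 hxy⟩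
    have h2 : eVariationOn γ (s ∩ Icc x y) = _ := h hx hy
    rw [h2] at h1
    rw [edist_comm x y, edist_dist, Real.dist_eq, abs_of_nonneg (by linarith)]
    simpa using h1
  intro x hx y hy
  rw [ENNReal.coe_one, one_mul]
  rcases le_total x y with hxy | hxy
  · exact key x hx y hy hxy
  · rw [edist_comm, edist_comm x]
    exact key y hy x hx hxy

theorem IsUniformDomain.exists_hasUniformCurves (hΩ : IsUniformDomain Ω)
    (hf : (frontier Ω).Nonempty) : ∃ K : ℝ, 1 ≤ K ∧ HasUniformCurves Ω K := by
  obtain ⟨-, -, K, hK, h⟩ := hΩ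
  refine ⟨K, hK, fun x hx y hy => ?_⟩
  obtain ⟨l, γ, hl, hm, hu, h0, h1, hlen, hd⟩ := h x hx y hy
  refine ⟨l, γ, hl, hm, hu.lipschitzOnWith, h0, h1, hlen, fun t ht => ?_⟩
  exact (ENNReal.ofReal_le_iff_le_toReal (infEDist_ne_top hf)).1 (hd t ht)

/-- The ball is connected and meets no frontier point, so `Ω` is relatively open and closed in it.
-/
theorem ball_boundaryDist_subset (hΩ : IsOpen Ω) {x : EuclideanSpace ℝ (Fin d)} (hx : x ∈ Ω) :
    ball x (boundaryDist Ω x) ⊆ Ω := by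
  rcases le_or_gt (boundaryDist Ω x) 0 with h0 | h0
  · simp [ball_eq_empty.2 h0]
  refine (convex_ball x _).isPreconnected.subset_of_closure_inter_subset hΩ
    ⟨x, mem_ball_self h0, hx⟩ ?_
  rintro y ⟨hy, hyb⟩
  by_contra hyn
  have : y ∈ frontier Ω := ⟨hy, by rwa [hΩ.interior_eq]⟩
  have h2 := infDist_le_dist_of_mem this (x := x)
  rw [mem_ball, dist_comm] at hyb
  exact absurd h2 (not_le.2 hyb)

theorem boundaryDist_le_add (Ω : Set (EuclideanSpace ℝ (Fin d))) (x y : EuclideanSpace ℝ (Fin d)) :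
    boundaryDist Ω x ≤ boundaryDist Ω y + dist x y := infDist_le_infDist_add_dist

/-- By the intermediate value theorem the curve from `x` to `y` crosses the sphere of radius `t`
about `x`; there the distance to `y` is still at least `t`. -/
theorem HasUniformCurves.exists_corkscrew {K : ℝ} (hK : 1 ≤ K) (h : HasUniformCurves Ω K)
    {x y : EuclideanSpace ℝ (Fin d)} (hx : x ∈ Ω) (hy : y ∈ Ω) {t : ℝ} (ht : 0 < t)
    (hxy : 2 * t ≤ dist x y) : ∃ p ∈ Ω, dist p x = t ∧ t / K ≤ boundaryDist Ω p := by
  obtain ⟨l, γ, hl, hm, hu, h0, h1, -, hd⟩ := h x hx y hy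
  have hc : ContinuousOn (fun r => dist (γ r) x) (Icc 0 l) :=
    (continuous_id.dist continuous_const).comp_continuousOn hu.continuousOn
  have := intermediate_value_Icc hl hc
  obtain ⟨r, hr, hrt⟩ := this (show t ∈ Icc _ _ by
    simp only [h0, h1, dist_self, dist_comm y x]
    constructor <;> linarith)
  refine ⟨γ r, hm hr, hrt, le_trans ?_ (hd r hr)⟩
  have h3 := dist_triangle_left x y (γ r)
  simp only at hrt
  gcongr
  exact le_min hrt.ge (by linarith)

/-- Two interior points at comparable distance are joined by a chain of boundedly many points with
small steps, staying away from the boundary. -/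
theorem HasUniformCurves.exists_chain {K : ℝ} (hK : 1 ≤ K) (h : HasUniformCurves Ω K)
    {a b : EuclideanSpace ℝ (Fin d)} (ha : a ∈ Ω) (hb : b ∈ Ω) {t ε : ℝ} (ht : 0 < t) {N : ℕ}
    (hN : 0 < N) (hNε : 6 * K ≤ ε * N) (hab : dist a b ≤ 6 * t)
    (hda : t / (2 * K) ≤ boundaryDist Ω a) (hdb : t / (2 * K) ≤ boundaryDist Ω b) :
    ∃ z : ℕ → EuclideanSpace ℝ (Fin d), z 0 = a ∧ z N = b ∧
      (∀ i ≤ N, z i ∈ Ω ∧ dist (z i) a ≤ 6 * K * t ∧ t / (4 * K ^ 2) ≤ boundaryDist Ω (z i)) ∧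
      ∀ i < N, dist (z i) (z (i + 1)) ≤ ε * t := by
  obtain ⟨l, γ, hl, hm, hu, h0, h1, hlen, hd⟩ := h a ha b hb
  have hN' : (0 : ℝ) < N := by exact_mod_cast hN
  have hlt : l ≤ 6 * K * t := by nlinarith
  have hmem : ∀ i : ℕ, i ≤ N → l * i / N ∈ Icc 0 l := by
    intro i hi
    have : (i : ℝ) ≤ N := by exact_mod_cast hi
    refine ⟨by positivity, ?_⟩
    rw [div_le_iff₀ hN']
    gcongr
  have hdist : ∀ r ∈ Icc 0 l, ∀ r' ∈ Icc 0 l, dist (γ r) (γ r') ≤ |r - r'| := by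
    intro r hr r' hr'
    simpa [Real.dist_eq] using hu.dist_le_mul r hr r' hr'
  refine ⟨fun i => γ (l * i / N), by simpa using h0, ?_, fun i hi => ⟨hm (hmem i hi), ?_, ?_⟩,
    fun i hi => ?_⟩
  · simp only [mul_div_cancel_right₀ l hN'.ne', h1]
  · have h2 := hdist _ (hmem i hi) 0 (left_mem_Icc.2 hl)
    rw [h0, sub_zero, abs_of_nonneg (hmem i hi).1] at h2
    exact h2.trans ((hmem i hi).2.trans hlt)
  · simp only
    set p := γ (l * i / N) with hp
    have h3 : t / (4 * K ^ 2) ≤ t / (4 * K) := by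
      gcongr
      nlinarith
    have h3' : t / (2 * K) = t / (4 * K) + t / (4 * K) := by field_simp; ring
    -- Close to an endpoint, half of that endpoint's depth survives because the boundary distance is
    -- 1-Lipschitz; elsewhere the curve condition gives the depth.
    rcases le_total (dist p a) (t / (4 * K)) with h4 | h4
    · have := boundaryDist_le_add Ω a p
      rw [dist_comm] at this
      linarith
    rcases le_total (dist p b) (t / (4 * K)) with h5 | h5
    · have := boundaryDist_le_add Ω b p
      rw [dist_comm] at this
      linarith
    refine le_trans ?_ (hd _ (hmem i hi))
    rw [← hp]
    calc t / (4 * K ^ 2) = t / (4 * K) / K := by field_simp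
      _ ≤ _ := by
        gcongr
        exact le_min h4 h5
  · refine (hdist _ (hmem i hi.le) _ (hmem (i + 1) hi)).trans ?_
    have : l * (i : ℝ) / N - l * ((i + 1 : ℕ) : ℝ) / N = -(l / N) := by
      push_cast; ring
    rw [this, abs_neg, abs_of_nonneg (by positivity), div_le_iff₀ hN']
    nlinarith

end Geometry

/-! ### Differences and limits of averages -/

section Averages

theorem edist_integral_le {α : Type*} [MeasurableSpace α] {ν : Measure α} [IsProbabilityMeasure ν]
    {f : α → ℝ} (hf : Integrable f ν) (c : ℝ) :
    edist (∫ z, f z ∂ν) c ≤ ∫⁻ z, edist (f z) c ∂ν := by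
  have : ∫ z, f z ∂ν - c = ∫ z, (f z - c) ∂ν := by
    rw [integral_sub hf (integrable_const c)]; simp
  rw [edist_eq_enorm_sub, this]
  simp only [edist_eq_enorm_sub]
  exact enorm_integral_le_lintegral_enorm _

theorem edist_setAverage_const_le {α : Type*} [MeasurableSpace α] {μ : Measure α} {B : Set α}
    {f : α → ℝ} (hf : IntegrableOn f B μ) (h0 : μ B ≠ 0) (h1 : μ B ≠ ∞) (c : ℝ) :
    edist (⨍ z in B, f z ∂μ) c ≤ (μ B)⁻¹ * ∫⁻ z in B, edist (f z) c ∂μ := by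
  have hp : IsProbabilityMeasure ((μ B)⁻¹ • μ.restrict B) := by
    constructor
    simp [ENNReal.inv_mul_cancel h0 h1]
  have h := edist_integral_le (ν := (μ B)⁻¹ • μ.restrict B)
    (Integrable.smul_measure hf (ENNReal.inv_ne_top.2 h0)) c
  rw [lintegral_smul_measure] at h
  simpa [average] using h

theorem edist_setAverage_le {α : Type*} [MeasurableSpace α] {μ : Measure α} {B B' : Set α}
    {f : α → ℝ} (hf : IntegrableOn f B μ) (hf' : IntegrableOn f B' μ) (h0 : μ B ≠ 0)
    (h1 : μ B ≠ ∞) (h0' : μ B' ≠ 0) (h1' : μ B' ≠ ∞) :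
    edist (⨍ z in B, f z ∂μ) (⨍ z in B', f z ∂μ) ≤
      (μ B)⁻¹ * (μ B')⁻¹ * ∫⁻ z in B, ∫⁻ z' in B', edist (f z) (f z') ∂μ ∂μ := by
  refine (edist_setAverage_const_le hf h0 h1 _).trans ?_
  rw [mul_assoc, ← lintegral_const_mul' _ _ (ENNReal.inv_ne_top.2 h0')]
  gcongr with z
  rw [edist_comm]
  refine (edist_setAverage_const_le hf' h0' h1' _).trans ?_
  simp only [edist_comm, le_refl]

/-- Lebesgue differentiation along balls not centred at `x`, localized: on each set of a countable
open cover, `f` is cut off to an integrable function, which agrees with `f` on the balls of small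
radius. -/
theorem LocallyIntegrableOn.ae_tendsto_setAverage {d : ℕ} {Ω : Set (EuclideanSpace ℝ (Fin d))}
    (hΩ : IsOpen Ω) {f : EuclideanSpace ℝ (Fin d) → ℝ} (hf : LocallyIntegrableOn f Ω volume)
    (K : ℝ) :
    ∀ᵐ x ∂(volume : Measure (EuclideanSpace ℝ (Fin d))), x ∈ Ω →
      ∀ (p : ℕ → EuclideanSpace ℝ (Fin d)) (δ : ℕ → ℝ), Tendsto δ atTop (𝓝[>] 0) →
        (∀ n, x ∈ closedBall (p n) (K * δ n)) →
        Tendsto (fun n => ⨍ y in closedBall (p n) (δ n), f y) atTop (𝓝 (f x)) := by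
  obtain ⟨T, hTc, hTo, hcov, hint⟩ := hf.exists_countable_integrableOn
  have key : ∀ u ∈ T, ∀ᵐ x ∂(volume : Measure (EuclideanSpace ℝ (Fin d))), x ∈ u → x ∈ Ω →
      ∀ (p : ℕ → EuclideanSpace ℝ (Fin d)) (δ : ℕ → ℝ), Tendsto δ atTop (𝓝[>] 0) →
        (∀ n, x ∈ closedBall (p n) (K * δ n)) →
        Tendsto (fun n => ⨍ y in closedBall (p n) (δ n), f y) atTop (𝓝 (f x)) := by
    intro u hu
    have huo : IsOpen (u ∩ Ω) := (hTo u hu).inter hΩ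
    have hg : LocallyIntegrable ((u ∩ Ω).indicator f) volume :=
      ((integrable_indicator_iff huo.measurableSet).2 (hint u hu)).locallyIntegrable
    filter_upwards [IsUnifLocDoublingMeasure.ae_tendsto_average volume hg K] with x hx hxu hxΩ p δ
      hδ hp
    have h1 := hx p δ hδ (Eventually.of_forall hp)
    rw [indicator_of_mem (show x ∈ u ∩ Ω from ⟨hxu, hxΩ⟩)] at h1
    refine h1.congr' ?_
    obtain ⟨ρ, hρ, hsub⟩ := Metric.isOpen_iff.1 huo x ⟨hxu, hxΩ⟩
    have hδ0 : Tendsto (fun n => K * δ n + δ n) atTop (𝓝 0) := by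
      have := tendsto_nhds_of_tendsto_nhdsWithin hδ
      simpa using (this.const_mul K).add this
    filter_upwards [hδ0.eventually (gt_mem_nhds hρ)] with n hn
    refine setAverage_congr_fun measurableSet_closedBall (ae_of_all _ fun y hy => ?_)
    refine indicator_of_mem (hsub ?_) _
    have h2 := hp n
    rw [mem_closedBall] at h2 hy
    rw [dist_comm] at h2
    exact mem_ball.2 (((dist_triangle y (p n) x).trans (by linarith)).trans_lt hn)
  have := (ae_ball_iff hTc).2 key
  filter_upwards [this] with x hx hxΩ
  obtain ⟨u, hu, hxu⟩ := mem_iUnion₂.1 (hcov hxΩ)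
  exact hx u hu hxu hxΩ

end Averages

/-! ### Pointwise control by oscillations at dyadic scales -/

section Oscillation

variable {d : ℕ}

/-- The part of `Ω` at distance at least `r` from the boundary. -/
def innerPart (Ω : Set (EuclideanSpace ℝ (Fin d))) (r : ℝ) : Set (EuclideanSpace ℝ (Fin d)) :=
  {z ∈ Ω | r ≤ boundaryDist Ω z}

/-- The weighted oscillation of `f` on the ball `B(z, r)`, relative to the value at `z`. -/
noncomputable def ballOsc (r : ℝ) (f : EuclideanSpace ℝ (Fin d) → ℝ) (W : EuclideanSpace ℝ (Fin d) → ℝ≥0∞)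
    (z : EuclideanSpace ℝ (Fin d)) : ℝ≥0∞ :=
  ∫⁻ z' in closedBall z r, edist (f z) (f z') * W z'

/-- The integral of the oscillation at scale `t` over the points of `B(x, M t)` at distance at least
`c t` from the boundary. -/
noncomputable def innerOsc (Ω : Set (EuclideanSpace ℝ (Fin d))) (c η M : ℝ) (f : EuclideanSpace ℝ (Fin d) → ℝ)
    (W : EuclideanSpace ℝ (Fin d) → ℝ≥0∞) (t : ℝ) (x : EuclideanSpace ℝ (Fin d)) : ℝ≥0∞ :=
  ∫⁻ z in innerPart Ω (c * t) ∩ closedBall x (M * t), ballOsc (η * t) f W z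

/-- The normalization of `innerOsc`. -/
noncomputable def scaleFactor (d : ℕ) (t : ℝ) : ℝ≥0∞ :=
  (volume (closedBall (0 : EuclideanSpace ℝ (Fin d)) t))⁻¹ *
    (volume (closedBall (0 : EuclideanSpace ℝ (Fin d)) t))⁻¹

theorem volume_closedBall_mul (x : EuclideanSpace ℝ (Fin d)) {a t : ℝ} (ha : 0 ≤ a) (ht : 0 ≤ t) :
    volume (closedBall x (a * t)) =
      ENNReal.ofReal (a ^ d) * volume (closedBall (0 : EuclideanSpace ℝ (Fin d)) t) := by
  rw [Measure.addHaar_closedBall _ _ (mul_nonneg ha ht), Measure.addHaar_closedBall _ _ ht, mul_pow,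
    ENNReal.ofReal_mul (by positivity), mul_assoc]
  simp

theorem inv_volume_le (x : EuclideanSpace ℝ (Fin d)) {a t r : ℝ} (ha : 0 < a) (ht : 0 < t)
    (hr : a * t ≤ r) :
    (volume (closedBall x r))⁻¹ ≤ (ENNReal.ofReal (a ^ d))⁻¹ *
      (volume (closedBall (0 : EuclideanSpace ℝ (Fin d)) t))⁻¹ := by
  rw [← ENNReal.mul_inv (.inr measure_closedBall_lt_top.ne)
    (.inr (measure_closedBall_pos _ _ ht).ne'), ← volume_closedBall_mul x ha.le ht.le]
  gcongr

variable {Ω : Set (EuclideanSpace ℝ (Fin d))} {f : EuclideanSpace ℝ (Fin d) → ℝ}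

theorem closedBall_subset_of_lt_boundaryDist (hΩ : IsOpen Ω) {x : EuclideanSpace ℝ (Fin d)}
    (hx : x ∈ Ω) {r : ℝ} (hr : r < boundaryDist Ω x) : closedBall x r ⊆ Ω :=
  (closedBall_subset_ball hr).trans (ball_boundaryDist_subset hΩ hx)

/-- One link of the chain. Both radii and the distance of the centres are at most `ε t`, hence the
oscillation radius `3 ε t`; depth `2 c t` at the centre leaves depth `c t` throughout the ball. -/
theorem edist_average_le_innerOsc (hΩ : IsOpen Ω) (hf : LocallyIntegrableOn f Ω volume)
    {c ε M t r r' : ℝ} (hε : 0 < ε) (hεc : ε ≤ c) (ht : 0 < t)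
    {a b x : EuclideanSpace ℝ (Fin d)} (ha : a ∈ Ω) (hb : b ∈ Ω)
    (hda : 2 * c * t ≤ boundaryDist Ω a) (hdb : 2 * c * t ≤ boundaryDist Ω b)
    (hr : ε / 2 * t ≤ r) (hr1 : r ≤ ε * t) (hr' : ε / 2 * t ≤ r') (hr1' : r' ≤ ε * t)
    (hab : dist a b ≤ ε * t) (hax : dist a x + ε * t ≤ M * t) :
    edist (⨍ z in closedBall a r, f z) (⨍ z in closedBall b r', f z) ≤
      (ENNReal.ofReal ((ε / 2) ^ d))⁻¹ * (ENNReal.ofReal ((ε / 2) ^ d))⁻¹ *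
        (scaleFactor d t * innerOsc Ω c (3 * ε) M f (fun _ => 1) t x) := by
  have hct : 0 < c * t := mul_pos (hε.trans_le hεc) ht
  have hεct : ε * t ≤ c * t := by gcongr
  have hsub : closedBall a r ⊆ Ω := closedBall_subset_of_lt_boundaryDist hΩ ha (by linarith)
  have hsub' : closedBall b r' ⊆ Ω := closedBall_subset_of_lt_boundaryDist hΩ hb (by linarith)
  have hr0 : 0 < r := lt_of_lt_of_le (by positivity) hr
  have hr0' : 0 < r' := lt_of_lt_of_le (by positivity) hr'
  refine (edist_setAverage_le (hf.integrableOn_compact_subset hsub (isCompact_closedBall _ _))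
    (hf.integrableOn_compact_subset hsub' (isCompact_closedBall _ _))
    (measure_closedBall_pos _ _ hr0).ne' measure_closedBall_lt_top.ne
    (measure_closedBall_pos _ _ hr0').ne' measure_closedBall_lt_top.ne).trans ?_
  have h1 : ∫⁻ z in closedBall a r, ∫⁻ z' in closedBall b r', edist (f z) (f z') ≤
      innerOsc Ω c (3 * ε) M f (fun _ => 1) t x := by
    have hsubset : closedBall a r ⊆ innerPart Ω (c * t) ∩ closedBall x (M * t) := by
      intro z hz
      rw [mem_closedBall] at hz
      refine ⟨⟨hsub hz, ?_⟩, ?_⟩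
      · have := boundaryDist_le_add Ω a z
        rw [dist_comm] at this
        linarith
      · rw [mem_closedBall]
        linarith [dist_triangle z a x]
    refine le_trans (setLIntegral_mono' measurableSet_closedBall fun z hz => ?_)
      (lintegral_mono_set hsubset)
    simp only [ballOsc, mul_one]
    refine lintegral_mono_set fun z' hz' => ?_
    rw [mem_closedBall] at hz hz' ⊢
    have := dist_triangle4 z' b a z
    rw [dist_comm b a, dist_comm a z] at this
    linarith
  calc _ ≤ ((ENNReal.ofReal ((ε / 2) ^ d))⁻¹ *
      (volume (closedBall (0 : EuclideanSpace ℝ (Fin d)) t))⁻¹) *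
      ((ENNReal.ofReal ((ε / 2) ^ d))⁻¹ *
      (volume (closedBall (0 : EuclideanSpace ℝ (Fin d)) t))⁻¹) * 
        innerOsc Ω c (3 * ε) M f (fun _ => 1) t x := by
        gcongr
        · exact inv_volume_le a (by positivity) ht hr
        · exact inv_volume_le b (by positivity) ht hr'
    _ = _ := by rw [scaleFactor]; ring

/-- The constant in the comparison of averages along a chain of length `N`. -/
noncomputable def chainConst (d : ℕ) (ε : ℝ) (N : ℕ) : ℝ≥0∞ :=
  (N + 1) * ((ENNReal.ofReal ((ε / 2) ^ d))⁻¹ * (ENNReal.ofReal ((ε / 2) ^ d))⁻¹)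

theorem chainConst_ne_top {ε : ℝ} (hε : 0 < ε) (N : ℕ) : chainConst d ε N ≠ ∞ := by
  have : (ENNReal.ofReal ((ε / 2) ^ d))⁻¹ ≠ ∞ :=
    ENNReal.inv_ne_top.2 (by simpa using by positivity)
  exact ENNReal.mul_ne_top (by simp) (ENNReal.mul_ne_top this this)

theorem HasUniformCurves.edist_average_le {K : ℝ} (hK : 1 ≤ K) (h : HasUniformCurves Ω K)
    (hΩ : IsOpen Ω) (hf : LocallyIntegrableOn f Ω volume)
    {ε t r : ℝ} {N : ℕ} (hε : 0 < ε) (hεc : ε ≤ 1 / (8 * K ^ 2)) (ht : 0 < t)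
    (hN : 0 < N) (hNε : 6 * K ≤ ε * N)
    {a b x : EuclideanSpace ℝ (Fin d)} (ha : a ∈ Ω) (hb : b ∈ Ω)
    (hab : dist a b ≤ 6 * t) (hda : t / (2 * K) ≤ boundaryDist Ω a)
    (hdb : t / (2 * K) ≤ boundaryDist Ω b) (hax : dist a x ≤ t)
    (hr : ε / 2 * t ≤ r) (hr1 : r ≤ ε * t) :
    edist (⨍ z in closedBall a (ε * t), f z) (⨍ z in closedBall b r, f z) ≤
      chainConst d ε N * (scaleFactor d t *
        innerOsc Ω (1 / (8 * K ^ 2)) (3 * ε) (6 * K + 2) f (fun _ => 1) t x) := by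
  obtain ⟨z, hz0, hzN, hz, hstep⟩ := h.exists_chain hK ha hb ht hN hNε hab hda hdb
  set c := 1 / (8 * K ^ 2) with hc
  have hc2 : t / (4 * K ^ 2) = 2 * c * t := by rw [hc]; field_simp; norm_num
  rw [hc2] at hz
  have hε1 : ε * t ≤ t := by
    have : ε ≤ 1 := hεc.trans (by rw [hc, div_le_one (by positivity)]; nlinarith)
    nlinarith
  set S := (ENNReal.ofReal ((ε / 2) ^ d))⁻¹ * (ENNReal.ofReal ((ε / 2) ^ d))⁻¹ *
        (scaleFactor d t * innerOsc Ω c (3 * ε) (6 * K + 2) f (fun _ => 1) t x) with hS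
  have hhalf : ε / 2 * t ≤ ε * t := by nlinarith
  have hclose : ∀ i ≤ N, dist (z i) x + ε * t ≤ (6 * K + 2) * t := fun i hi => by
    linarith [dist_triangle (z i) a x, (hz i hi).2.1]
  have h1 : edist (⨍ y in closedBall (z 0) (ε * t), f y) (⨍ y in closedBall (z N) (ε * t), f y) ≤
      ∑ i ∈ Finset.range N, S :=
    edist_le_range_sum_of_edist_le (f := fun i => ⨍ y in closedBall (z i) (ε * t), f y) N
      fun {i} hi => edist_average_le_innerOsc hΩ hf hε hεc ht (hz i hi.le).1 (hz (i + 1) hi).1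
        (hz i hi.le).2.2 (hz (i + 1) hi).2.2 hhalf le_rfl hhalf le_rfl (hstep i hi)
        (hclose i hi.le)
  -- An extra link at `b` changes the radius from `ε * t` to `r`; it accounts for the `N + 1` in
  -- `chainConst`.
  have h2 : edist (⨍ y in closedBall (z N) (ε * t), f y) (⨍ y in closedBall (z N) r, f y) ≤ S :=
    edist_average_le_innerOsc hΩ hf hε hεc ht (hz N le_rfl).1 (hz N le_rfl).1
        (hz N le_rfl).2.2 (hz N le_rfl).2.2 hhalf le_rfl hr hr1
        (by rw [dist_self]; positivity) (hclose N le_rfl)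
  rw [hz0, hzN] at h1
  rw [hzN] at h2
  refine (edist_triangle _ _ _).trans ((add_le_add h1 h2).trans (le_of_eq ?_))
  rw [Finset.sum_const, Finset.card_range, nsmul_eq_mul, hS, chainConst]
  ring

/-- The sum of the normalized oscillations near `x` at the dyadic scales up to `ρ`. -/
noncomputable def dyadicOsc (Ω : Set (EuclideanSpace ℝ (Fin d))) (c η M : ℝ) (f : EuclideanSpace ℝ (Fin d) → ℝ)
    (ρ : ℝ) (x : EuclideanSpace ℝ (Fin d)) : ℝ≥0∞ :=
  ∑' k : ℤ, if (2 : ℝ) ^ k ≤ ρ then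
    scaleFactor d (2 ^ k) * innerOsc Ω c η M f (fun _ => 1) (2 ^ k) x else 0

theorem tsum_scales_le_dyadicOsc (Ω : Set (EuclideanSpace ℝ (Fin d))) (c η M : ℝ)
    (f : EuclideanSpace ℝ (Fin d) → ℝ) {ρ : ℝ} (x : EuclideanSpace ℝ (Fin d)) {m : ℤ}
    (hm : (2 : ℝ) ^ m ≤ ρ) :
    ∑' n : ℕ, scaleFactor d (2 ^ (m - n)) * innerOsc Ω c η M f (fun _ => 1) (2 ^ (m - n)) x ≤
      dyadicOsc Ω c η M f ρ x := by
  have hinj : Function.Injective fun n : ℕ => m - (n : ℤ) := fun a b hab => by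
    simp only at hab; omega
  refine le_trans (le_of_eq (tsum_congr fun n => ?_)) (ENNReal.tsum_comp_le_tsum_of_injective hinj _)
  rw [if_pos]
  refine le_trans ?_ hm
  exact zpow_le_zpow_right₀ (by norm_num) (by omega)

/-- Telescoping along the points `p n`, whose averages converge to `f x`. -/
theorem HasUniformCurves.edist_average_value_le {K : ℝ} (hK : 1 ≤ K) (h : HasUniformCurves Ω K)
    (hΩ : IsOpen Ω) (hf : LocallyIntegrableOn f Ω volume)
    {ε : ℝ} {N : ℕ} (hε : 0 < ε) (hεc : ε ≤ 1 / (8 * K ^ 2))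
    (hN : 0 < N) (hNε : 6 * K ≤ ε * N) {x : EuclideanSpace ℝ (Fin d)}
    (hleb : ∀ (p : ℕ → EuclideanSpace ℝ (Fin d)) (δ : ℕ → ℝ), Tendsto δ atTop (𝓝[>] 0) →
        (∀ n, x ∈ closedBall (p n) (ε⁻¹ * δ n)) →
        Tendsto (fun n => ⨍ y in closedBall (p n) (δ n), f y) atTop (𝓝 (f x)))
    {ρ : ℝ} {m : ℤ} (hm : (2 : ℝ) ^ m ≤ ρ) {p : ℕ → EuclideanSpace ℝ (Fin d)}
    (hp : ∀ n, p n ∈ Ω ∧ dist (p n) x = 2 ^ (m - n) ∧ 2 ^ (m - n) / K ≤ boundaryDist Ω (p n)) :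
    edist (⨍ z in closedBall (p 0) (ε * 2 ^ m), f z) (f x) ≤
      chainConst d ε N * dyadicOsc Ω (1 / (8 * K ^ 2)) (3 * ε) (6 * K + 2) f ρ x := by
  have hpos : ∀ n : ℕ, (0 : ℝ) < 2 ^ (m - n) := fun n => by positivity
  have hhalf : ∀ n : ℕ, (2 : ℝ) ^ (m - ((n + 1 : ℕ) : ℤ)) = 2 ^ (m - n) / 2 := fun n => by
    rw [div_eq_mul_inv, ← zpow_sub_one₀ (by norm_num)]; congr 1; push_cast; ring
  have hlim0 : Tendsto (fun n : ℕ => ε * (2 : ℝ) ^ (m - n)) atTop (𝓝 0) := by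
    have h1 : ∀ n : ℕ, ε * (2 : ℝ) ^ (m - n) = ε * 2 ^ m * (1 / 2) ^ n := fun n => by
      rw [zpow_sub₀ (by norm_num), zpow_natCast]; field_simp; simp
    simp only [h1]
    simpa using (tendsto_pow_atTop_nhds_zero_of_lt_one (r := (1 / 2 : ℝ)) (by norm_num)
      (by norm_num)).const_mul (ε * 2 ^ m)
  -- The point `p n` lies at distance `2 ^ (m - n)` from `x`, which is `ε⁻¹` times the radius of its
  -- ball.
  have hlim := hleb p (fun n => ε * 2 ^ (m - n))
    (tendsto_nhdsWithin_iff.2 ⟨hlim0, Eventually.of_forall fun n => mul_pos hε (hpos n)⟩)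
    (fun n => by
      rw [inv_mul_cancel_left₀ hε.ne', mem_closedBall, dist_comm]
      exact (hp n).2.1.le)
  have hstep := edist_le_tsum_of_edist_le_of_tendsto₀
    (f := fun n : ℕ => ⨍ y in closedBall (p n) (ε * 2 ^ (m - n)), f y)
    (fun n => chainConst d ε N * (scaleFactor d (2 ^ (m - n)) *
        innerOsc Ω (1 / (8 * K ^ 2)) (3 * ε) (6 * K + 2) f (fun _ => 1) (2 ^ (m - n)) x))
    (fun n => by
      have h1 := hp n
      have h2 := hp (n + 1)
      simp only [Nat.succ_eq_add_one]
      -- Relative to `t = 2 ^ (m - n)`, the next point has depth `t / (2 * K)` and ball radius `ε /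
      -- 2 * t`, the weakest values the chain estimate admits.
      rw [hhalf] at h2 ⊢
      have hn := hpos n
      refine h.edist_average_le hK hΩ hf hε hεc hn hN hNε h1.1 h2.1 ?_ ?_ ?_ h1.2.1.le ?_ ?_
      · have := dist_triangle_right (p n) (p (n + 1)) x
        linarith
      · refine le_trans ?_ h1.2.2
        gcongr
        linarith
      · refine le_trans (le_of_eq ?_) h2.2.2
        field_simp
      · linarith
      · nlinarith)
    hlim
  simp only [Nat.cast_zero, sub_zero] at hstep
  refine hstep.trans ?_
  rw [ENNReal.tsum_mul_left]
  gcongr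
  exact tsum_scales_le_dyadicOsc Ω _ _ _ f x hm

/-- The pointwise estimate: the difference of the values of `f` at almost all points is controlled
by the oscillations at the dyadic scales up to the distance of the points. -/
theorem HasUniformCurves.ae_edist_le {K : ℝ} (hK : 1 ≤ K) (h : HasUniformCurves Ω K)
    (hΩ : IsOpen Ω) (hf : LocallyIntegrableOn f Ω volume)
    {ε : ℝ} {N : ℕ} (hε : 0 < ε) (hεc : ε ≤ 1 / (8 * K ^ 2))
    (hN : 0 < N) (hNε : 6 * K ≤ ε * N) :
    ∀ᵐ x ∂(volume.restrict Ω), ∀ᵐ y ∂(volume.restrict Ω),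
      edist (f x) (f y) ≤ 2 * chainConst d ε N *
        (dyadicOsc Ω (1 / (8 * K ^ 2)) (3 * ε) (6 * K + 2) f (dist x y) x +
          dyadicOsc Ω (1 / (8 * K ^ 2)) (3 * ε) (6 * K + 2) f (dist x y) y) := by
  have hleb := (ae_restrict_iff' hΩ.measurableSet).2
    (LocallyIntegrableOn.ae_tendsto_setAverage hΩ hf ε⁻¹)
  filter_upwards [hleb, ae_restrict_mem hΩ.measurableSet] with x hx hxΩ
  filter_upwards [hleb, ae_restrict_mem hΩ.measurableSet] with y hy hyΩ
  rcases eq_or_ne x y with rfl | hxy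
  · simp
  have hρ : 0 < dist x y / 2 := by
    have := dist_pos.2 hxy
    linarith
  -- From `2 * 2 ^ m ≤ dist x y < 4 * 2 ^ m`: interior points exist at every scale `2 ^ (m - n)`,
  -- and `p 0`, `q 0` are at most `6 * 2 ^ m` apart.
  obtain ⟨m, hm1, hm2⟩ := exists_mem_Ico_zpow hρ (one_lt_two (α := ℝ))
  rw [zpow_add_one₀ (by norm_num)] at hm2
  have hscale : ∀ n : ℕ, 2 * (2 : ℝ) ^ (m - n) ≤ dist x y := fun n => by
    have : (2 : ℝ) ^ (m - n) ≤ 2 ^ m := zpow_le_zpow_right₀ (by norm_num) (by omega)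
    linarith
  choose p hp using fun n : ℕ => h.exists_corkscrew hK hxΩ hyΩ
    (show (0 : ℝ) < 2 ^ (m - n) by positivity) (hscale n)
  choose q hq using fun n : ℕ => h.exists_corkscrew hK hyΩ hxΩ
    (show (0 : ℝ) < 2 ^ (m - n) by positivity) (by rw [dist_comm]; exact hscale n)
  have hmρ : (2 : ℝ) ^ m ≤ dist x y := by linarith
  have hm0 : (0 : ℝ) < 2 ^ m := by positivity
  have h1 := h.edist_average_value_le hK hΩ hf hε hεc hN hNε hx hmρ hp
  have h2 := h.edist_average_value_le hK hΩ hf hε hεc hN hNε hy hmρ hq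
  have hp0 := hp 0
  have hq0 := hq 0
  simp only [Nat.cast_zero, sub_zero] at hp0 hq0
  have hK2 : (2 : ℝ) ^ m / (2 * K) ≤ 2 ^ m / K := by
    gcongr
    linarith
  have h3 : edist (⨍ z in closedBall (p 0) (ε * 2 ^ m), f z)
      (⨍ z in closedBall (q 0) (ε * 2 ^ m), f z) ≤ chainConst d ε N *
        dyadicOsc Ω (1 / (8 * K ^ 2)) (3 * ε) (6 * K + 2) f (dist x y) x := by
    refine (h.edist_average_le hK hΩ hf hε hεc hm0 hN hNε hp0.1 hq0.1 ?_ (hK2.trans hp0.2.2)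
      (hK2.trans hq0.2.2) hp0.2.1.le (by nlinarith) le_rfl).trans ?_
    · have := dist_triangle4 (p 0) x y (q 0)
      rw [dist_comm y (q 0)] at this
      linarith
    · gcongr
      refine le_trans ?_ (tsum_scales_le_dyadicOsc Ω _ _ _ f x hmρ)
      -- The link between `p 0` and `q 0` is a term of the dyadic sum, the one at scale `2 ^ m`.
      refine le_trans (le_of_eq ?_) (ENNReal.le_tsum 0)
      simp
  calc edist (f x) (f y) ≤ edist (f x) (⨍ z in closedBall (p 0) (ε * 2 ^ m), f z) +
        edist (⨍ z in closedBall (p 0) (ε * 2 ^ m), f z)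
          (⨍ z in closedBall (q 0) (ε * 2 ^ m), f z) +
        edist (⨍ z in closedBall (q 0) (ε * 2 ^ m), f z) (f y) := edist_triangle4 _ _ _ _
    _ ≤ _ := add_le_add_three ((edist_comm _ _).trans_le h1) h3 h2
    _ ≤ chainConst d ε N * dyadicOsc Ω (1 / (8 * K ^ 2)) (3 * ε) (6 * K + 2) f (dist x y) x +
        chainConst d ε N * dyadicOsc Ω (1 / (8 * K ^ 2)) (3 * ε) (6 * K + 2) f (dist x y) x +
        (chainConst d ε N * dyadicOsc Ω (1 / (8 * K ^ 2)) (3 * ε) (6 * K + 2) f (dist x y) y +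
        chainConst d ε N * dyadicOsc Ω (1 / (8 * K ^ 2)) (3 * ε) (6 * K + 2) f (dist x y) y) := by
      gcongr
      exact le_self_add
    _ = _ := by ring

end Oscillation

/-! ### Geometric sums over dyadic scales -/

theorem exists_tsum_dyadic_le {α : ℝ} (hα : 0 < α) : ∃ C : ℝ≥0∞, C ≠ ∞ ∧ ∀ r : ℝ, 0 < r →
    ∑' k : ℤ, (if r ≤ (2 : ℝ) ^ k then ENNReal.ofReal (((2 : ℝ) ^ k) ^ (-α)) else 0) ≤
      C * ENNReal.ofReal (r ^ (-α)) := by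
  have hq : ENNReal.ofReal ((2 : ℝ) ^ (-α)) < 1 := by
    rw [ENNReal.ofReal_lt_one]
    exact Real.rpow_lt_one_of_one_lt_of_neg (by norm_num) (by linarith)
  refine ⟨(1 - ENNReal.ofReal ((2 : ℝ) ^ (-α)))⁻¹ * ENNReal.ofReal (2 ^ α),
    ENNReal.mul_ne_top (ENNReal.inv_ne_top.2 (tsub_pos_of_lt hq).ne') ENNReal.ofReal_ne_top,
    fun r hr => ?_⟩
  -- All scales `2 ^ k ≥ r` have `k ≥ m`, so the sum is at most a geometric series starting at `2 ^
  -- m`, which exceeds `r / 2`.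
  obtain ⟨m, hm1, hm2⟩ := exists_mem_Ico_zpow hr (one_lt_two (α := ℝ))
  have hinj : Function.Injective fun n : ℕ => m + (n : ℤ) := fun a b hab => by
    simp only at hab; omega
  rw [← hinj.tsum_eq]
  · have hterm : ∀ n : ℕ, ENNReal.ofReal (((2 : ℝ) ^ (m + (n : ℤ))) ^ (-α)) =
        ENNReal.ofReal (((2 : ℝ) ^ m) ^ (-α)) * ENNReal.ofReal ((2 : ℝ) ^ (-α)) ^ n := fun n => by
      rw [zpow_add₀ (by norm_num), Real.mul_rpow (by positivity) (by positivity),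
        ENNReal.ofReal_mul (by positivity), zpow_natCast, ← Real.rpow_natCast_mul (by norm_num),
        mul_comm (n : ℝ), Real.rpow_mul_natCast (by norm_num), ENNReal.ofReal_pow (by positivity)]
    calc _ ≤ ∑' n : ℕ, ENNReal.ofReal (((2 : ℝ) ^ m) ^ (-α)) *
          ENNReal.ofReal ((2 : ℝ) ^ (-α)) ^ n := by
          refine ENNReal.tsum_le_tsum fun n => ?_
          rw [← hterm]
          split_ifs <;> simp
      _ = (1 - ENNReal.ofReal ((2 : ℝ) ^ (-α)))⁻¹ * ENNReal.ofReal (((2 : ℝ) ^ m) ^ (-α)) := by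
          rw [ENNReal.tsum_mul_left, ENNReal.tsum_geometric, mul_comm]
      _ ≤ (1 - ENNReal.ofReal ((2 : ℝ) ^ (-α)))⁻¹ *
          (ENNReal.ofReal (2 ^ α) * ENNReal.ofReal (r ^ (-α))) := by
          gcongr
          rw [← ENNReal.ofReal_mul (by positivity)]
          apply ENNReal.ofReal_le_ofReal
          have h2 : (2 : ℝ) ^ α = (2⁻¹ : ℝ) ^ (-α) := by
            rw [Real.inv_rpow (by norm_num), Real.rpow_neg (by norm_num), inv_inv]
          rw [h2, ← Real.mul_rpow (by norm_num) hr.le]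
          refine Real.rpow_le_rpow_of_nonpos (by positivity) ?_ (by linarith)
          rw [zpow_add_one₀ (by norm_num)] at hm2
          linarith
      _ = _ := by ring
  · intro k hk
    rw [Function.mem_support, ne_eq, ite_eq_right_iff, Classical.not_imp] at hk
    have : m ≤ k := (zpow_le_zpow_iff_right₀ (one_lt_two (α := ℝ))).1 (hm1.trans hk.1)
    exact ⟨(k - m).toNat, by simp only; omega⟩

/-! ### Kernel tails, weights and summation over scales -/

section Kernel

variable {d : ℕ}

/-- The kernel `|x - y|^{-(d+s)}`. -/
noncomputable def fracKernel (s : ℝ) (x y : EuclideanSpace ℝ (Fin d)) : ℝ≥0∞ :=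
  ENNReal.ofReal ((dist x y ^ ((d : ℝ) + s))⁻¹)

theorem fracKernel_comm (s : ℝ) (x y : EuclideanSpace ℝ (Fin d)) :
    fracKernel s x y = fracKernel s y x := by
  rw [fracKernel, fracKernel, dist_comm]

theorem measurable_fracKernel (s : ℝ) :
    Measurable fun p : EuclideanSpace ℝ (Fin d) × EuclideanSpace ℝ (Fin d) =>
      fracKernel s p.1 p.2 := by
  unfold fracKernel
  fun_prop

theorem fracKernel_le {s t : ℝ} (hs : 0 < s) (ht : 0 < t) {x y : EuclideanSpace ℝ (Fin d)}
    (h : t ≤ dist x y) : fracKernel s x y ≤ ENNReal.ofReal (t ^ (-((d : ℝ) + s))) := by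
  rw [fracKernel, Real.rpow_neg ht.le]
  apply ENNReal.ofReal_le_ofReal
  gcongr

theorem ofReal_rpow_mul_pow {s t : ℝ} (ht : 0 < t) :
    ENNReal.ofReal (t ^ (-((d : ℝ) + s))) * ENNReal.ofReal (t ^ d) = ENNReal.ofReal (t ^ (-s)) := by
  rw [← ENNReal.ofReal_mul (by positivity), ← Real.rpow_natCast t d, ← Real.rpow_add ht]
  congr 2
  ring

/-- The tail of the kernel, integrated against a weight in the class `A₁`. -/
theorem exists_lintegral_tail_le {s : ℝ} (hs : 0 < s) {A : ℝ≥0∞} (hA : A ≠ ∞)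
    {W : EuclideanSpace ℝ (Fin d) → ℝ≥0∞} (hWm : Measurable W) (hW : IsPointwiseA1 A W) {L : ℝ}
    (hL : 0 ≤ L) :
    ∃ C : ℝ≥0∞, C ≠ ∞ ∧ ∀ᵐ z ∂(volume : Measure (EuclideanSpace ℝ (Fin d))),
      ∀ (x : EuclideanSpace ℝ (Fin d)) (k : ℤ), dist z x ≤ L * 2 ^ k →
        ∫⁻ y in {y | (2 : ℝ) ^ k ≤ dist x y}, fracKernel s x y * W y ≤
          C * ENNReal.ofReal (((2 : ℝ) ^ k) ^ (-s)) * W z := by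
  obtain ⟨C, hC, hsum⟩ := exists_tsum_dyadic_le hs
  refine ⟨A * ENNReal.ofReal ((2 + L) ^ d) * C, ENNReal.mul_ne_top (ENNReal.mul_ne_top hA
    ENNReal.ofReal_ne_top) hC, ?_⟩
  filter_upwards [hW] with z hz x k hzx
  set τ : ℤ → ℝ := fun j => (2 : ℝ) ^ j with hτ
  have hτ0 : ∀ j, 0 < τ j := fun j => by positivity
  have hmeas : MeasurableSet {y | τ k ≤ dist x y} :=
    measurableSet_le measurable_const (by fun_prop)
  -- The tail is split into the shells `τ j ≤ dist x y < 2 * τ j` with `j ≥ k`.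
  calc ∫⁻ y in {y | τ k ≤ dist x y}, fracKernel s x y * W y
      ≤ ∫⁻ y, ∑' j : ℤ, (if τ k ≤ τ j then ENNReal.ofReal (τ j ^ (-((d : ℝ) + s))) else 0) *
          (closedBall x (2 * τ j)).indicator W y := by
        rw [← lintegral_indicator hmeas]
        refine lintegral_mono fun y => ?_
        refine indicator_apply_le' (fun hy => ?_) (fun _ => bot_le)
        obtain ⟨j, hj1, hj2⟩ := exists_mem_Ico_zpow ((hτ0 k).trans_le hy) (one_lt_two (α := ℝ))
        refine le_trans ?_ (ENNReal.le_tsum j)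
        rw [zpow_add_one₀ (by norm_num)] at hj2
        have hkj : τ k ≤ τ j := by
          have h1 : (2 : ℝ) ^ k < 2 ^ (j + 1) := by
            rw [zpow_add_one₀ (by norm_num)]
            exact lt_of_le_of_lt hy hj2
          have := (zpow_lt_zpow_iff_right₀ (one_lt_two (α := ℝ))).1 h1
          exact zpow_le_zpow_right₀ (by norm_num) (by omega)
        rw [if_pos hkj, indicator_of_mem]
        · gcongr
          exact fracKernel_le hs (hτ0 j) hj1
        · rw [mem_closedBall, dist_comm]
          linarith
    _ = ∑' j : ℤ, (if τ k ≤ τ j then ENNReal.ofReal (τ j ^ (-((d : ℝ) + s))) else 0) *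
          ∫⁻ y in closedBall x (2 * τ j), W y := by
        rw [lintegral_tsum fun j =>
          ((hWm.indicator measurableSet_closedBall).const_mul _).aemeasurable]
        refine tsum_congr fun j => ?_
        rw [lintegral_const_mul _ (hWm.indicator measurableSet_closedBall),
          lintegral_indicator measurableSet_closedBall]
    _ ≤ ∑' j : ℤ, (A * ENNReal.ofReal ((2 + L) ^ d) * W z) *
          (if τ k ≤ τ j then ENNReal.ofReal (τ j ^ (-s)) else 0) := by
        refine ENNReal.tsum_le_tsum fun j => ?_
        split_ifs with hkj
        -- The ball is recentred at `z`, where the `A₁` bound is available; `dist z x ≤ L * τ k ≤ L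
        -- * τ j`.
        · have hsub : closedBall x (2 * τ j) ⊆ closedBall z ((2 + L) * τ j) := by
            intro y hy
            rw [mem_closedBall] at hy ⊢
            have h1 := dist_triangle y x z
            rw [dist_comm x z] at h1
            have h2 : L * 2 ^ k ≤ L * τ j := by gcongr
            linarith
          have h3 := (lintegral_mono_set hsub).trans (hz ((2 + L) * τ j) (by
            have := hτ0 j; positivity))
          calc _ ≤ ENNReal.ofReal (τ j ^ (-((d : ℝ) + s))) *
              (A * ENNReal.ofReal (((2 + L) * τ j) ^ d) * W z) := by gcongr
            _ = (A * ENNReal.ofReal ((2 + L) ^ d) * W z) *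
              (ENNReal.ofReal (τ j ^ (-((d : ℝ) + s))) * ENNReal.ofReal (τ j ^ d)) := by
                rw [mul_pow, ENNReal.ofReal_mul (by positivity)]; ring
            _ = _ := by rw [ofReal_rpow_mul_pow (hτ0 j)]
        · simp
    _ ≤ (A * ENNReal.ofReal ((2 + L) ^ d) * W z) * (C * ENNReal.ofReal (τ k ^ (-s))) := by
        rw [ENNReal.tsum_mul_left]
        gcongr
        exact hsum _ (hτ0 k)
    _ = _ := by ring

theorem measurable_setLIntegral_closedBall {α : Type*} [PseudoMetricSpace α]
    [SecondCountableTopology α] [MeasurableSpace α] [BorelSpace α] {μ : Measure α} [SFinite μ]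
    {F : α → α → ℝ≥0∞} (hF : Measurable (Function.uncurry F)) (r : ℝ) :
    Measurable fun z => ∫⁻ z' in closedBall z r, F z z' ∂μ := by
  have hS : MeasurableSet {p : α × α | dist p.2 p.1 ≤ r} :=
    measurableSet_le (by fun_prop) measurable_const
  have := (hF.indicator hS).lintegral_prod_right' (ν := μ)
  convert this using 2 with z
  rw [← lintegral_indicator measurableSet_closedBall]
  rfl

theorem measurable_boundaryDist (Ω : Set (EuclideanSpace ℝ (Fin d))) :
    Measurable (boundaryDist Ω) := measurable_infDist

theorem measurableSet_innerPart {Ω : Set (EuclideanSpace ℝ (Fin d))} (hΩ : IsOpen Ω) (r : ℝ) :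
    MeasurableSet (innerPart Ω r) :=
  hΩ.measurableSet.inter (measurableSet_le measurable_const (measurable_boundaryDist Ω))

variable {f : EuclideanSpace ℝ (Fin d) → ℝ} {W V : EuclideanSpace ℝ (Fin d) → ℝ≥0∞}

theorem measurable_edist_mul (hf : Measurable f) (hW : Measurable W) :
    Measurable (Function.uncurry fun z z' => edist (f z) (f z') * W z') := by
  unfold Function.uncurry
  fun_prop

theorem measurable_ballOsc (hf : Measurable f) (hW : Measurable W) (r : ℝ) :
    Measurable (ballOsc r f W) :=
  measurable_setLIntegral_closedBall (measurable_edist_mul hf hW) r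

theorem measurable_innerOsc (Ω : Set (EuclideanSpace ℝ (Fin d)))
    (hf : Measurable f) (hW : Measurable W) (c η M t : ℝ) :
    Measurable (innerOsc Ω c η M f W t) := by
  have h := measurable_setLIntegral_closedBall
    (μ := volume.restrict (innerPart Ω (c * t)))
    (F := fun _ z => ballOsc (η * t) f W z) ((measurable_ballOsc hf hW _).comp measurable_snd)
    (M * t)
  have e : innerOsc Ω c η M f W t = fun x => ∫⁻ z in closedBall x (M * t), ballOsc (η * t) f W z
      ∂(volume.restrict (innerPart Ω (c * t))) := by
    funext x
    rw [innerOsc, Measure.restrict_restrict measurableSet_closedBall, inter_comm]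
  rw [e]
  exact h

theorem measurable_dyadicOsc (Ω : Set (EuclideanSpace ℝ (Fin d)))
    (hf : Measurable f) (c η M : ℝ) :
    Measurable fun p : EuclideanSpace ℝ (Fin d) × EuclideanSpace ℝ (Fin d) =>
      dyadicOsc Ω c η M f (dist p.1 p.2) p.1 := by
  unfold dyadicOsc
  refine Measurable.tsum fun k => Measurable.ite
    (measurableSet_le measurable_const (by fun_prop)) ?_ measurable_const
  exact ((measurable_innerOsc Ω hf measurable_const c η M _).comp measurable_fst).const_mul _

/-- The oscillations around `x`, times the tail of the kernel at `x`. -/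
theorem innerOsc_mul_le {Ω : Set (EuclideanSpace ℝ (Fin d))} (hf : Measurable f)
    {c η M t : ℝ} {x : EuclideanSpace ℝ (Fin d)} {T D : ℝ≥0∞}
    (h : ∀ᵐ z ∂(volume : Measure (EuclideanSpace ℝ (Fin d))), dist z x ≤ (M + η) * t →
      T ≤ D * W z) (hW : Measurable W) :
    innerOsc Ω c η M f (fun _ => 1) t x * T ≤ D * innerOsc Ω c η M f W t x := by
  unfold innerOsc
  rw [← lintegral_const_mul _ (measurable_ballOsc hf hW _)]
  refine (lintegral_mul_const_le _ _).trans ?_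
  refine (lintegral_mono_ae ?_)
  have hm : ∀ᵐ z ∂(volume.restrict (innerPart Ω (c * t) ∩ closedBall x (M * t))),
      z ∈ closedBall x (M * t) := by
    refine ae_mono (Measure.restrict_mono inter_subset_right le_rfl)
      (ae_restrict_mem measurableSet_closedBall)
  filter_upwards [hm] with z hz
  unfold ballOsc
  rw [← lintegral_const_mul _ ((measurable_edist_mul hf hW).of_uncurry_left)]
  refine (lintegral_mul_const_le _ _).trans ?_
  refine setLIntegral_mono_ae' measurableSet_closedBall ?_
  -- The bound for `T` is applied at `z'` rather than `z`, which places `W` inside the oscillation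
  -- and leaves `z` free for the other weight.
  filter_upwards [h] with z' hz' hzz
  rw [mem_closedBall] at hz hzz
  have h1 := hz' (by linarith [dist_triangle z' z x])
  calc _ = edist (f z) (f z') * T := by rw [mul_one]
    _ ≤ edist (f z) (f z') * (D * W z') := by gcongr
    _ = _ := by ring

/-- After Fubini, `V` is integrated over `closedBall z (M * t)`, and `A₁` turns this into a multiple
of `V z`. -/
theorem lintegral_mul_innerOsc_le {Ω : Set (EuclideanSpace ℝ (Fin d))}
    (hf : Measurable f) (hW : Measurable W) (hVm : Measurable V) {A : ℝ≥0∞}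
    (hV : IsPointwiseA1 A V) {c η M t : ℝ} (hM : 0 < M) (ht : 0 < t) :
    ∫⁻ x in Ω, V x * innerOsc Ω c η M f W t x ≤ A * ENNReal.ofReal ((M * t) ^ d) *
      ∫⁻ z in innerPart Ω (c * t), ballOsc (η * t) f W z * V z := by
  have hb := measurable_ballOsc hf hW (η * t)
  have hS : MeasurableSet {p : EuclideanSpace ℝ (Fin d) × EuclideanSpace ℝ (Fin d) |
      dist p.2 p.1 ≤ M * t} := measurableSet_le (by fun_prop) measurable_const
  calc ∫⁻ x in Ω, V x * innerOsc Ω c η M f W t x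
      ≤ ∫⁻ x, ∫⁻ z in innerPart Ω (c * t), {p : EuclideanSpace ℝ (Fin d) ×
          EuclideanSpace ℝ (Fin d) | dist p.2 p.1 ≤ M * t}.indicator
          (fun p => V p.1 * ballOsc (η * t) f W p.2) (x, z) := by
        refine (setLIntegral_le_lintegral _ _).trans (lintegral_mono fun x => ?_)
        rw [innerOsc, inter_comm, ← Measure.restrict_restrict measurableSet_closedBall,
          ← lintegral_const_mul _ hb, ← lintegral_indicator measurableSet_closedBall]
        exact le_rfl
    _ = ∫⁻ z in innerPart Ω (c * t), ∫⁻ x, {p : EuclideanSpace ℝ (Fin d) ×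
          EuclideanSpace ℝ (Fin d) | dist p.2 p.1 ≤ M * t}.indicator
          (fun p => V p.1 * ballOsc (η * t) f W p.2) (x, z) := by
        refine lintegral_lintegral_swap ?_
        exact (((hVm.comp measurable_fst).mul (hb.comp measurable_snd)).indicator hS).aemeasurable
    _ ≤ ∫⁻ z in innerPart Ω (c * t), A * ENNReal.ofReal ((M * t) ^ d) *
          (ballOsc (η * t) f W z * V z) := by
        refine lintegral_mono_ae (ae_restrict_of_ae ?_)
        filter_upwards [hV] with z hz
        have h1 : ∫⁻ x, {p : EuclideanSpace ℝ (Fin d) ×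
          EuclideanSpace ℝ (Fin d) | dist p.2 p.1 ≤ M * t}.indicator
          (fun p => V p.1 * ballOsc (η * t) f W p.2) (x, z) =
          (∫⁻ x in closedBall z (M * t), V x) * ballOsc (η * t) f W z := by
          rw [← lintegral_mul_const _ hVm, ← lintegral_indicator measurableSet_closedBall]
          refine lintegral_congr fun x => ?_
          simp only [indicator, mem_ofPred_eq, mem_closedBall, dist_comm z x]
        rw [h1]
        calc _ ≤ (A * ENNReal.ofReal ((M * t) ^ d) * V z) * ballOsc (η * t) f W z := by
              gcongr
              exact hz _ (by positivity)
          _ = _ := by ring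
    _ = _ := lintegral_const_mul _ (hb.mul hVm)

/-- Summation over the scales recovers the kernel. -/
theorem exists_tsum_innerPart_le {s c η θ : ℝ} (hs : 0 < s) (hη : 0 < η) (hηθ : η < θ * c)
    (hθ : 0 < θ) :
    ∃ C : ℝ≥0∞, C ≠ ∞ ∧ ∀ (Ω : Set (EuclideanSpace ℝ (Fin d))), IsOpen Ω →
      ∀ (f : EuclideanSpace ℝ (Fin d) → ℝ) (W V : EuclideanSpace ℝ (Fin d) → ℝ≥0∞),
        Measurable f → Measurable W → Measurable V →
      ∑' k : ℤ, ENNReal.ofReal (((2 : ℝ) ^ k) ^ (-((d : ℝ) + s))) *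
        ∫⁻ z in innerPart Ω (c * 2 ^ k), ballOsc (η * 2 ^ k) f W z * V z ≤
      C * ∫⁻ z in Ω, ∫⁻ z' in ball z (θ * boundaryDist Ω z),
        edist (f z) (f z') * fracKernel s z z' * (W z' * V z) := by
  obtain ⟨C, hC, hsum⟩ := exists_tsum_dyadic_le (show 0 < (d : ℝ) + s by positivity)
  refine ⟨C * ENNReal.ofReal (η⁻¹ ^ (-((d : ℝ) + s))), ENNReal.mul_ne_top hC ENNReal.ofReal_ne_top,
    fun Ω hΩ f W V hf hW hV => ?_⟩
  set D := C * ENNReal.ofReal (η⁻¹ ^ (-((d : ℝ) + s))) with hD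
  have hDtop : D ≠ ∞ := ENNReal.mul_ne_top hC ENNReal.ofReal_ne_top
  set q : ℤ → ℝ≥0∞ := fun k => ENNReal.ofReal (((2 : ℝ) ^ k) ^ (-((d : ℝ) + s))) with hq
  have hb := fun k : ℤ => measurable_ballOsc hf hW (η * 2 ^ k)
  have hi := fun k : ℤ => measurableSet_innerPart hΩ (c * 2 ^ k)
  have hpt : ∀ z z' : EuclideanSpace ℝ (Fin d), z ∈ Ω →
      ∑' k : ℤ, q k * (innerPart Ω (c * 2 ^ k)).indicator (fun z =>
        (closedBall z (η * 2 ^ k)).indicator (fun z' => edist (f z) (f z') * W z') z' * V z) z ≤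
      D * (ball z (θ * boundaryDist Ω z)).indicator
        (fun z' => edist (f z) (f z') * fracKernel s z z' * (W z' * V z)) z' := by
    intro z z' hz
    by_cases hzz : z' ∈ ball z (θ * boundaryDist Ω z)
    · rw [indicator_of_mem hzz]
      rcases eq_or_ne z z' with rfl | hne
      · simp
      have hpos : 0 < dist z z' := dist_pos.2 hne
      -- Only scales with `dist z z' ≤ η * 2 ^ k` contribute, and their sum is comparable to the
      -- kernel.
      calc _ ≤ ∑' k : ℤ, (if η⁻¹ * dist z z' ≤ (2 : ℝ) ^ k then q k else 0) *
            (edist (f z) (f z') * W z' * V z) := by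
            refine ENNReal.tsum_le_tsum fun k => ?_
            by_cases h1 : η⁻¹ * dist z z' ≤ (2 : ℝ) ^ k
            · rw [if_pos h1]
              gcongr
              refine indicator_apply_le' (fun _ => ?_) (fun _ => bot_le)
              gcongr
              exact indicator_apply_le' (fun _ => le_rfl) (fun _ => bot_le)
            · have h2 : z' ∉ closedBall z (η * 2 ^ k) := fun h => h1 <| by
                rw [mem_closedBall, dist_comm] at h
                rwa [inv_mul_le_iff₀ hη]
              rw [if_neg h1, zero_mul, nonpos_iff_eq_zero, mul_eq_zero]
              right
              refine indicator_apply_eq_zero.2 fun _ => ?_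
              rw [indicator_of_notMem h2, zero_mul]
        _ ≤ C * ENNReal.ofReal ((η⁻¹ * dist z z') ^ (-((d : ℝ) + s))) *
            (edist (f z) (f z') * W z' * V z) := by
            rw [ENNReal.tsum_mul_right]
            gcongr
            exact hsum _ (by positivity)
        _ = _ := by
            rw [Real.mul_rpow (by positivity) hpos.le, ENNReal.ofReal_mul (by positivity),
              Real.rpow_neg hpos.le, hD, fracKernel]
            ring
    -- Outside the truncation ball every term vanishes: depth at least `c * 2 ^ k` and `dist z' z ≤
    -- η * 2 ^ k` would give `dist z' z < θ * boundaryDist Ω z`.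
    · rw [indicator_of_notMem hzz, mul_zero, nonpos_iff_eq_zero, ENNReal.tsum_eq_zero]
      intro k
      rw [mul_eq_zero]
      right
      refine indicator_apply_eq_zero.2 fun h1 => ?_
      rw [indicator_of_notMem, zero_mul]
      intro h2
      refine hzz ?_
      rw [mem_closedBall] at h2
      rw [mem_ball]
      have h3 : (0 : ℝ) < 2 ^ k := by positivity
      calc dist z' z ≤ η * 2 ^ k := h2
        _ < θ * c * 2 ^ k := by gcongr
        _ = θ * (c * 2 ^ k) := by ring
        _ ≤ _ := by gcongr; exact h1.2
  have hinner : ∀ z (k : ℤ), Measurable fun z' => q k * (innerPart Ω (c * 2 ^ k)).indicator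
      (fun z => (closedBall z (η * 2 ^ k)).indicator
        (fun z' => edist (f z) (f z') * W z') z' * V z) z := by
    intro z k
    by_cases h1 : z ∈ innerPart Ω (c * 2 ^ k)
    · simp only [indicator_of_mem h1]
      exact ((((measurable_edist_mul hf hW).of_uncurry_left).indicator
        measurableSet_closedBall).mul_const _).const_mul _
    · simp only [indicator_of_notMem h1]
      exact measurable_const
  calc ∑' k : ℤ, q k * ∫⁻ z in innerPart Ω (c * 2 ^ k), ballOsc (η * 2 ^ k) f W z * V z
      = ∑' k : ℤ, ∫⁻ z in Ω, q k * (innerPart Ω (c * 2 ^ k)).indicator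
          (fun z => ballOsc (η * 2 ^ k) f W z * V z) z := by
        refine tsum_congr fun k => ?_
        have hm : Measurable ((innerPart Ω (c * 2 ^ k)).indicator
          fun z => ballOsc (η * 2 ^ k) f W z * V z) := ((hb k).mul hV).indicator (hi k)
        rw [lintegral_const_mul _ hm, lintegral_indicator (hi k), Measure.restrict_restrict (hi k),
          inter_eq_left.2 (show innerPart Ω (c * 2 ^ k) ⊆ Ω from fun z hz => hz.1)]
    _ = ∫⁻ z in Ω, ∑' k : ℤ, q k * (innerPart Ω (c * 2 ^ k)).indicator
          (fun z => ballOsc (η * 2 ^ k) f W z * V z) z :=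
        (lintegral_tsum fun k =>
          ((((hb k).mul hV).indicator (hi k)).const_mul _).aemeasurable).symm
    _ = ∫⁻ z in Ω, ∫⁻ z', ∑' k : ℤ, q k * (innerPart Ω (c * 2 ^ k)).indicator (fun z =>
          (closedBall z (η * 2 ^ k)).indicator (fun z' => edist (f z) (f z') * W z') z' * V z) z := by
        refine lintegral_congr fun z => ?_
        rw [lintegral_tsum fun k => (hinner z k).aemeasurable]
        refine tsum_congr fun k => ?_
        by_cases h1 : z ∈ innerPart Ω (c * 2 ^ k)
        · simp only [indicator_of_mem h1]
          have hm := ((measurable_edist_mul hf hW).of_uncurry_left (x := z)).indicator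
            (measurableSet_closedBall (x := z) (ε := η * 2 ^ k))
          rw [lintegral_const_mul _ (hm.mul_const _), lintegral_mul_const _ hm,
            lintegral_indicator measurableSet_closedBall, ballOsc]
        · simp [indicator_of_notMem h1]
    _ ≤ ∫⁻ z in Ω, D * ∫⁻ z' in ball z (θ * boundaryDist Ω z),
          edist (f z) (f z') * fracKernel s z z' * (W z' * V z) := by
        refine setLIntegral_mono' hΩ.measurableSet fun z hz => ?_
        rw [← lintegral_const_mul' _ _ hDtop, ← lintegral_indicator measurableSet_ball]
        refine lintegral_mono fun z' => (hpt z z' hz).trans (le_of_eq ?_)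
        simp only [indicator]
        split_ifs <;> simp
    _ = _ := lintegral_const_mul' _ _ hDtop

/-- The normalization scales as `t^(-2d)`; the factor `t ^ d` gained from `V` leaves `t^(-d)`. -/
theorem scaleFactor_mul (t : ℝ) (ht : 0 < t) :
    scaleFactor d t * ENNReal.ofReal (t ^ d) =
      scaleFactor d 1 * (ENNReal.ofReal (t ^ d))⁻¹ := by
  have hv := volume_closedBall_mul (0 : EuclideanSpace ℝ (Fin d)) ht.le zero_le_one
  rw [mul_one] at hv
  have h0 : ENNReal.ofReal (t ^ d) ≠ 0 := by simpa using pow_pos ht d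
  have h1 : ENNReal.ofReal (t ^ d) ≠ ∞ := ENNReal.ofReal_ne_top
  rw [scaleFactor, scaleFactor, hv, ENNReal.mul_inv (.inl h0) (.inl h1)]
  calc _ = (ENNReal.ofReal (t ^ d))⁻¹ * ((ENNReal.ofReal (t ^ d))⁻¹ * ENNReal.ofReal (t ^ d)) *
        ((volume (closedBall (0 : EuclideanSpace ℝ (Fin d)) 1))⁻¹ *
          (volume (closedBall (0 : EuclideanSpace ℝ (Fin d)) 1))⁻¹) := by ring
    _ = _ := by rw [ENNReal.inv_mul_cancel h0 h1]; ring

theorem ofReal_rpow_mul_inv_pow {s t : ℝ} (ht : 0 < t) :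
    ENNReal.ofReal (t ^ (-s)) * (ENNReal.ofReal (t ^ d))⁻¹ =
      ENNReal.ofReal (t ^ (-((d : ℝ) + s))) := by
  rw [← ENNReal.ofReal_inv_of_pos (by positivity), ← ENNReal.ofReal_mul (by positivity),
    ← Real.rpow_natCast t d, ← Real.rpow_neg ht.le, ← Real.rpow_add ht]
  congr 2
  ring

theorem scaleFactor_one_ne_top : scaleFactor d 1 ≠ ∞ := by
  have : (volume (closedBall (0 : EuclideanSpace ℝ (Fin d)) 1))⁻¹ ≠ ∞ :=
    ENNReal.inv_ne_top.2 (measure_closedBall_pos _ _ zero_lt_one).ne'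
  exact ENNReal.mul_ne_top this this

/-- The weighted double integral of the dyadic oscillations is controlled by the truncated
seminorm. -/
theorem exists_lintegral_dyadicOsc_le {s c η M θ : ℝ} (hs : 0 < s) (hη : 0 < η) (hM : 0 < M)
    (hηθ : η < θ * c) (hθ : 0 < θ) {A B : ℝ≥0∞} (hA : A ≠ ∞) (hB : B ≠ ∞)
    (hWm : Measurable W) (hVm : Measurable V) (hW : IsPointwiseA1 A W) (hV : IsPointwiseA1 B V) :
    ∃ C : ℝ≥0∞, C ≠ ∞ ∧ ∀ (Ω : Set (EuclideanSpace ℝ (Fin d))), IsOpen Ω →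
      ∀ f : EuclideanSpace ℝ (Fin d) → ℝ, Measurable f →
      ∫⁻ x in Ω, ∫⁻ y in Ω, dyadicOsc Ω c η M f (dist x y) x * (fracKernel s x y * (W y * V x)) ≤
      C * ∫⁻ z in Ω, ∫⁻ z' in ball z (θ * boundaryDist Ω z),
        edist (f z) (f z') * fracKernel s z z' * (W z' * V z) := by
  obtain ⟨C₁, hC₁, htail⟩ := exists_lintegral_tail_le hs hA hWm hW (show 0 ≤ M + η by positivity)
  obtain ⟨C₂, hC₂, hsum⟩ := exists_tsum_innerPart_le (d := d) hs hη hηθ hθ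
  obtain ⟨D, hD⟩ : ∃ D, D = C₁ * B * ENNReal.ofReal (M ^ d) * scaleFactor d 1 := ⟨_, rfl⟩
  have hDtop : D ≠ ∞ := by
    have h1 := ENNReal.mul_ne_top (ENNReal.mul_ne_top hC₁ hB)
      (ENNReal.ofReal_ne_top (r := M ^ d))
    rw [hD]
    exact ENNReal.mul_ne_top h1 scaleFactor_one_ne_top
  refine ⟨D * C₂, ENNReal.mul_ne_top hDtop hC₂, fun Ω hΩ f hf => ?_⟩
  set τ : ℤ → ℝ := fun k => (2 : ℝ) ^ k with hτ
  have hτ0 : ∀ k, 0 < τ k := fun k => by positivity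
  have hk : ∀ x : EuclideanSpace ℝ (Fin d), Measurable (fracKernel s x) := fun x => by
    unfold fracKernel
    fun_prop
  have hmeas : ∀ x k, MeasurableSet {y : EuclideanSpace ℝ (Fin d) | τ k ≤ dist x y} := fun x k =>
    measurableSet_le measurable_const (by fun_prop)
  have hinner : ∀ x, ∫⁻ y in Ω, dyadicOsc Ω c η M f (dist x y) x *
        (fracKernel s x y * (W y * V x)) ≤
      ∑' k : ℤ, C₁ * (scaleFactor d (τ k) * ENNReal.ofReal (τ k ^ (-s))) *
        (V x * innerOsc Ω c η M f W (τ k) x) := by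
    intro x
    have hkW : Measurable fun y => fracKernel s x y * W y := (hk x).mul hWm
    calc _ ≤ ∫⁻ y, ∑' k : ℤ, scaleFactor d (τ k) * innerOsc Ω c η M f (fun _ => 1) (τ k) x * V x *
          {y | τ k ≤ dist x y}.indicator (fun y => fracKernel s x y * W y) y := by
          refine (setLIntegral_le_lintegral _ _).trans (le_of_eq (lintegral_congr fun y => ?_))
          rw [dyadicOsc, ← ENNReal.tsum_mul_right]
          refine tsum_congr fun k => ?_
          simp only [indicator, mem_ofPred_eq]
          split_ifs
          · ring
          · simp
      _ = ∑' k : ℤ, scaleFactor d (τ k) * innerOsc Ω c η M f (fun _ => 1) (τ k) x * V x *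
          ∫⁻ y in {y | τ k ≤ dist x y}, fracKernel s x y * W y := by
          rw [lintegral_tsum fun k =>
            ((hkW.indicator (hmeas x k)).const_mul _).aemeasurable]
          refine tsum_congr fun k => ?_
          rw [lintegral_const_mul _ (hkW.indicator (hmeas x k)),
            lintegral_indicator (hmeas x k)]
      _ ≤ _ := by
          refine ENNReal.tsum_le_tsum fun k => ?_
          have h1 := innerOsc_mul_le (Ω := Ω) hf (c := c) (η := η) (M := M) (t := τ k) (x := x)
            (T := ∫⁻ y in {y | τ k ≤ dist x y}, fracKernel s x y * W y)
            (D := C₁ * ENNReal.ofReal (τ k ^ (-s))) (W := W)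
            (by filter_upwards [htail] with z hz hzx using hz x k hzx) hWm
          calc _ = scaleFactor d (τ k) * V x * (innerOsc Ω c η M f (fun _ => 1) (τ k) x *
                ∫⁻ y in {y | τ k ≤ dist x y}, fracKernel s x y * W y) := by ring
            _ ≤ scaleFactor d (τ k) * V x * (C₁ * ENNReal.ofReal (τ k ^ (-s)) *
                innerOsc Ω c η M f W (τ k) x) := by gcongr
            _ = _ := by ring
  have hVo : ∀ k, Measurable fun x => V x * innerOsc Ω c η M f W (τ k) x := fun k => hVm.mul (measurable_innerOsc Ω hf hWm c η M (τ k))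
  calc _ ≤ ∫⁻ x in Ω, ∑' k : ℤ, C₁ * (scaleFactor d (τ k) * ENNReal.ofReal (τ k ^ (-s))) *
        (V x * innerOsc Ω c η M f W (τ k) x) := lintegral_mono fun x => hinner x
    _ = ∑' k : ℤ, C₁ * (scaleFactor d (τ k) * ENNReal.ofReal (τ k ^ (-s))) *
        ∫⁻ x in Ω, V x * innerOsc Ω c η M f W (τ k) x := by
        rw [lintegral_tsum fun k => ((hVo k).const_mul _).aemeasurable]
        exact tsum_congr fun k => lintegral_const_mul _ (hVo k)
    _ ≤ ∑' k : ℤ, D * (ENNReal.ofReal (τ k ^ (-((d : ℝ) + s))) *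
        ∫⁻ z in innerPart Ω (c * τ k), ballOsc (η * τ k) f W z * V z) := by
        refine ENNReal.tsum_le_tsum fun k => ?_
        set I := ∫⁻ z in innerPart Ω (c * τ k), ballOsc (η * τ k) f W z * V z with hI
        calc _ ≤ C₁ * (scaleFactor d (τ k) * ENNReal.ofReal (τ k ^ (-s))) *
              (B * ENNReal.ofReal ((M * τ k) ^ d) * I) := by
              gcongr
              exact lintegral_mul_innerOsc_le hf hWm hVm hV hM (hτ0 k)
          _ = C₁ * B * ENNReal.ofReal (M ^ d) * ENNReal.ofReal (τ k ^ (-s)) *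
              (scaleFactor d (τ k) * ENNReal.ofReal (τ k ^ d)) * I := by
              rw [mul_pow, ENNReal.ofReal_mul (by positivity)]; ring
          _ = D * (ENNReal.ofReal (τ k ^ (-s)) * (ENNReal.ofReal (τ k ^ d))⁻¹) * I := by
              rw [scaleFactor_mul _ (hτ0 k), hD]; ring
          _ = _ := by rw [ofReal_rpow_mul_inv_pow (hτ0 k)]; ring
    _ ≤ D * (C₂ * ∫⁻ z in Ω, ∫⁻ z' in ball z (θ * boundaryDist Ω z),
        edist (f z) (f z') * fracKernel s z z' * (W z' * V z)) := by
        rw [ENNReal.tsum_mul_left]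
        gcongr
        exact hsum Ω hΩ f W V hf hWm hVm
    _ = _ := by ring

end Kernel

/-! ### Comparison of the full and truncated energies -/

section Energy

variable {d : ℕ} {s θ : ℝ} {Ω : Set (EuclideanSpace ℝ (Fin d))}
  {f f' : EuclideanSpace ℝ (Fin d) → ℝ} {W V : EuclideanSpace ℝ (Fin d) → ℝ≥0∞}

/-- The seminorm with weights in `[0, ∞]`. -/
noncomputable def fullEnergy (s : ℝ) (Ω : Set (EuclideanSpace ℝ (Fin d)))
    (f : EuclideanSpace ℝ (Fin d) → ℝ) (W V : EuclideanSpace ℝ (Fin d) → ℝ≥0∞) : ℝ≥0∞ :=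
  ∫⁻ x in Ω, ∫⁻ y in Ω, edist (f x) (f y) * fracKernel s x y * (W y * V x)

/-- The truncated seminorm with a non-symmetrized weight in `[0, ∞]`. -/
noncomputable def truncEnergy (s θ : ℝ) (Ω : Set (EuclideanSpace ℝ (Fin d)))
    (f : EuclideanSpace ℝ (Fin d) → ℝ) (W V : EuclideanSpace ℝ (Fin d) → ℝ≥0∞) : ℝ≥0∞ :=
  ∫⁻ x in Ω, ∫⁻ y in ball x (θ * boundaryDist Ω x),
    edist (f x) (f y) * fracKernel s x y * (W y * V x)

theorem measurable_energy_integrand (s : ℝ) (hf : Measurable f) (hW : Measurable W)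
    (hV : Measurable V) :
    Measurable (Function.uncurry fun x y =>
      edist (f x) (f y) * fracKernel s x y * (W y * V x)) := by
  have := measurable_fracKernel (d := d) s
  unfold Function.uncurry
  fun_prop

theorem fullEnergy_swap (hf : Measurable f) (hW : Measurable W) (hV : Measurable V) :
    fullEnergy s Ω f W V = fullEnergy s Ω f V W := by
  unfold fullEnergy
  rw [lintegral_lintegral_swap (measurable_energy_integrand s hf hW hV).aemeasurable]
  refine lintegral_congr fun y => lintegral_congr fun x => ?_
  rw [edist_comm, fracKernel_comm, mul_comm (W y)]

theorem ball_mul_boundaryDist_subset (hΩ : IsOpen Ω) (hθ : θ ≤ 1) {x : EuclideanSpace ℝ (Fin d)}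
    (hx : x ∈ Ω) : ball x (θ * boundaryDist Ω x) ⊆ Ω :=
  (ball_subset_ball (mul_le_of_le_one_left infDist_nonneg hθ)).trans
    (ball_boundaryDist_subset hΩ hx)

theorem truncEnergy_le_fullEnergy (hΩ : IsOpen Ω) (hθ : θ ≤ 1) :
    truncEnergy s θ Ω f W V ≤ fullEnergy s Ω f W V :=
  setLIntegral_mono' hΩ.measurableSet fun _ hx =>
    lintegral_mono_set (ball_mul_boundaryDist_subset hΩ hθ hx)

theorem lintegral_ball_boundaryDist_measurable (Ω : Set (EuclideanSpace ℝ (Fin d))) (θ : ℝ)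
    {F : EuclideanSpace ℝ (Fin d) → EuclideanSpace ℝ (Fin d) → ℝ≥0∞}
    (hF : Measurable (Function.uncurry F)) :
    Measurable fun x => ∫⁻ y in ball x (θ * boundaryDist Ω x), F x y := by
  have hb := measurable_boundaryDist Ω
  have hS : MeasurableSet {p : EuclideanSpace ℝ (Fin d) × EuclideanSpace ℝ (Fin d) |
      dist p.2 p.1 < θ * boundaryDist Ω p.1} := measurableSet_lt (by fun_prop) (by fun_prop)
  have := (hF.indicator hS).lintegral_prod_right' (ν := volume)
  convert this using 2 with z
  rw [← lintegral_indicator measurableSet_ball]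
  rfl

theorem truncEnergy_add (hf : Measurable f) (hW : Measurable W) (hV : Measurable V) :
    truncEnergy s θ Ω f W V + truncEnergy s θ Ω f V W =
      ∫⁻ x in Ω, ∫⁻ y in ball x (θ * boundaryDist Ω x),
        edist (f x) (f y) * fracKernel s x y * (W x * V y + W y * V x) := by
  have hm := measurable_energy_integrand s hf hW hV
  unfold truncEnergy
  rw [← lintegral_add_left (lintegral_ball_boundaryDist_measurable Ω θ hm)]
  refine lintegral_congr fun x => ?_
  have hx : Measurable fun y => edist (f x) (f y) * fracKernel s x y * (W y * V x) :=
    hm.comp measurable_prodMk_left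
  rw [← lintegral_add_left hx]
  refine lintegral_congr fun y => ?_
  ring

/-- Interchanging `x` and `y` in the part with `R y x` exchanges the two weights, so only `R x y`
has to be estimated. -/
theorem fullEnergy_le_of_ae_edist_le (hW : Measurable W)
    (hV : Measurable V) {D : ℝ≥0∞} (hD : D ≠ ∞)
    {R : EuclideanSpace ℝ (Fin d) → EuclideanSpace ℝ (Fin d) → ℝ≥0∞}
    (hR : Measurable fun p : EuclideanSpace ℝ (Fin d) × EuclideanSpace ℝ (Fin d) => R p.1 p.2)
    (h : ∀ᵐ x ∂(volume.restrict Ω), ∀ᵐ y ∂(volume.restrict Ω), edist (f x) (f y) ≤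
      D * (R x y + R y x)) :
    fullEnergy s Ω f W V ≤ D *
      ((∫⁻ x in Ω, ∫⁻ y in Ω, R x y * (fracKernel s x y * (W y * V x))) +
        ∫⁻ x in Ω, ∫⁻ y in Ω, R x y * (fracKernel s x y * (V y * W x))) := by
  have hκ := measurable_fracKernel (d := d) s
  have h1 : Measurable (Function.uncurry fun x y : EuclideanSpace ℝ (Fin d) =>
      R x y * (fracKernel s x y * (W y * V x))) := by
    unfold Function.uncurry
    fun_prop
  have h2 : Measurable (Function.uncurry fun x y : EuclideanSpace ℝ (Fin d) =>
      R x y * (fracKernel s x y * (V y * W x))) := by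
    unfold Function.uncurry
    fun_prop
  rw [lintegral_lintegral_swap (f := fun x y =>
      R x y * (fracKernel s x y * (V y * W x))) h2.aemeasurable,
    ← lintegral_add_left h1.lintegral_prod_right, ← lintegral_const_mul' _ _ hD]
  refine lintegral_mono_ae ?_
  filter_upwards [h] with x hx
  have h1x : Measurable fun y => R x y * (fracKernel s x y * (W y * V x)) :=
    h1.comp measurable_prodMk_left
  rw [← lintegral_add_left h1x, ← lintegral_const_mul' _ _ hD]
  refine lintegral_mono_ae ?_
  filter_upwards [hx] with y hxy
  rw [fracKernel_comm s y x]
  calc _ ≤ D * (R x y + R y x) * fracKernel s x y * (W y * V x) := by gcongr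
    _ = _ := by ring

theorem exists_fullEnergy_le (hs : 0 < s) (hθ0 : 0 < θ) (hθ1 : θ ≤ 1) (hΩ : IsOpen Ω) {K : ℝ}
    (hK : 1 ≤ K) (h : HasUniformCurves Ω K) {A B : ℝ≥0∞} (hA : A ≠ ∞) (hB : B ≠ ∞)
    (hWm : Measurable W) (hVm : Measurable V) (hW : IsPointwiseA1 A W) (hV : IsPointwiseA1 B V) :
    ∃ C : ℝ≥0∞, C ≠ ∞ ∧ ∀ f : EuclideanSpace ℝ (Fin d) → ℝ, Measurable f →
      LocallyIntegrableOn f Ω volume →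
        fullEnergy s Ω f W V ≤ C * (truncEnergy s θ Ω f W V + truncEnergy s θ Ω f V W) := by
  set c : ℝ := 1 / (8 * K ^ 2) with hc
  have hc0 : 0 < c := by positivity
  -- This choice makes the oscillation radius factor `3 * ε` smaller than `θ * c`, as the truncation
  -- requires, and keeps `ε ≤ c`.
  set ε : ℝ := θ * c / 4 with hε
  have hε0 : 0 < ε := by positivity
  have hεc : ε ≤ c := by
    rw [hε]; nlinarith
  have hηθ : 3 * ε < θ * c := by
    have : 0 < θ * c := by positivity
    rw [hε]; linarith
  obtain ⟨N, hN⟩ := exists_nat_gt (6 * K / ε)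
  have hN0 : 0 < N := by
    have : (0 : ℝ) < N := lt_of_le_of_lt (by positivity) hN
    exact_mod_cast this
  have hNε : 6 * K ≤ ε * N := by
    rw [div_lt_iff₀ hε0] at hN
    linarith
  obtain ⟨C₁, hC₁, h₁⟩ := exists_lintegral_dyadicOsc_le hs (show 0 < 3 * ε by positivity)
    (show 0 < 6 * K + 2 by positivity) hηθ hθ0 hA hB hWm hVm hW hV
  obtain ⟨C₂, hC₂, h₂⟩ := exists_lintegral_dyadicOsc_le hs (show 0 < 3 * ε by positivity)
    (show 0 < 6 * K + 2 by positivity) hηθ hθ0 hB hA hVm hWm hV hW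
  have hD : 2 * chainConst d ε N ≠ ∞ :=
    ENNReal.mul_ne_top (by simp) (chainConst_ne_top hε0 N)
  refine ⟨2 * chainConst d ε N * (C₁ + C₂), ENNReal.mul_ne_top hD (ENNReal.add_ne_top.2 ⟨hC₁, hC₂⟩),
    fun f hf hfl => ?_⟩
  refine (fullEnergy_le_of_ae_edist_le hWm hVm hD
    (R := fun x y => dyadicOsc Ω c (3 * ε) (6 * K + 2) f (dist x y) x)
    (measurable_dyadicOsc Ω hf c (3 * ε) (6 * K + 2)) ?_).trans ?_
  · filter_upwards [h.ae_edist_le hK hΩ hfl hε0 hεc hN0 hNε] with x hx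
    filter_upwards [hx] with y hxy
    rwa [dist_comm y x]
  rw [mul_assoc (2 * chainConst d ε N)]
  refine mul_le_mul' le_rfl ?_
  calc _ ≤ C₁ * truncEnergy s θ Ω f W V + C₂ * truncEnergy s θ Ω f V W :=
        add_le_add (h₁ Ω hΩ f hf) (h₂ Ω hΩ f hf)
    _ ≤ (C₁ + C₂) * truncEnergy s θ Ω f W V + (C₁ + C₂) * truncEnergy s θ Ω f V W := by
        gcongr
        · exact le_self_add
        · exact le_add_self
    _ = _ := (mul_add _ _ _).symm

variable {w v : EuclideanSpace ℝ (Fin d) → ℝ}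

theorem ofReal_abs_sub_div (f : EuclideanSpace ℝ (Fin d) → ℝ) (x y : EuclideanSpace ℝ (Fin d)) :
    ENNReal.ofReal (|f x - f y| / dist x y ^ ((d : ℝ) + s)) =
      edist (f x) (f y) * fracKernel s x y := by
  rw [div_eq_mul_inv, ENNReal.ofReal_mul (abs_nonneg _), fracKernel, edist_dist, Real.dist_eq]

theorem gagliardoSeminorm_one_eq (hff' : f =ᵐ[volume.restrict Ω] f')
    (hw : ∀ᵐ x ∂(volume : Measure (EuclideanSpace ℝ (Fin d))), 0 < w x)
    (hW : (fun x => ENNReal.ofReal (w x)) =ᵐ[volume] W)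
    (hV : (fun x => ENNReal.ofReal (v x)) =ᵐ[volume] V) :
    gagliardoSeminorm s 1 w v Ω f = fullEnergy s Ω f' W V := by
  unfold gagliardoSeminorm fullEnergy
  rw [div_one, ENNReal.rpow_one]
  refine lintegral_congr_ae ?_
  filter_upwards [hff', ae_restrict_of_ae hV] with x hx hVx
  refine lintegral_congr_ae ?_
  filter_upwards [hff', ae_restrict_of_ae hW, ae_restrict_of_ae hw] with y hy hWy hwy
  rw [Real.rpow_one, mul_one, ENNReal.ofReal_mul (by positivity), ofReal_abs_sub_div,
    ENNReal.ofReal_mul hwy.le, hx, hy, hVx, hWy]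

/-- As `θ ≤ 1`, the inner balls stay in `Ω`, so replacing `f` by a function equal to it almost
everywhere in `Ω` has no effect. -/
theorem truncatedSeminorm_eq (hΩ : IsOpen Ω) (hθ : θ ≤ 1) (hff' : f =ᵐ[volume.restrict Ω] f')
    (hw : ∀ᵐ x ∂(volume : Measure (EuclideanSpace ℝ (Fin d))), 0 < w x)
    (hv : ∀ᵐ x ∂(volume : Measure (EuclideanSpace ℝ (Fin d))), 0 < v x)
    (hW : (fun x => ENNReal.ofReal (w x)) =ᵐ[volume] W)
    (hV : (fun x => ENNReal.ofReal (v x)) =ᵐ[volume] V)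
    (hf' : Measurable f') (hWm : Measurable W) (hVm : Measurable V) :
    truncatedSeminorm s θ w v Ω f = truncEnergy s θ Ω f' W V + truncEnergy s θ Ω f' V W := by
  rw [truncEnergy_add hf' hWm hVm]
  unfold truncatedSeminorm
  refine lintegral_congr_ae ?_
  filter_upwards [hff', ae_restrict_of_ae hV, ae_restrict_of_ae hW, ae_restrict_of_ae hw,
    ae_restrict_of_ae hv, ae_restrict_mem hΩ.measurableSet] with x hx hVx hWx hwx hvx hxΩ
  refine lintegral_congr_ae ?_
  filter_upwards [ae_restrict_of_ae_restrict_of_subset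
    (ball_mul_boundaryDist_subset hΩ hθ hxΩ) hff', ae_restrict_of_ae hW, ae_restrict_of_ae hV,
    ae_restrict_of_ae hw, ae_restrict_of_ae hv] with y hy hWy hVy hwy hvy
  rw [ENNReal.ofReal_mul (by positivity), ofReal_abs_sub_div,
    ENNReal.ofReal_add (by positivity) (by positivity), ENNReal.ofReal_mul hwx.le,
    ENNReal.ofReal_mul hwy.le, hx, hy, hVx, hWy, hWx, hVy]

theorem IsMuckenhouptA1.exists_measurable (hw : IsMuckenhouptA1 w) :
    ∃ (A : ℝ≥0∞) (W : EuclideanSpace ℝ (Fin d) → ℝ≥0∞), A ≠ ∞ ∧ Measurable W ∧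
      (fun x => ENNReal.ofReal (w x)) =ᵐ[volume] W ∧ IsPointwiseA1 A W := by
  obtain ⟨A, hA, h⟩ := hw.exists_isPointwiseA1
  have hm : AEMeasurable (fun x => ENNReal.ofReal (w x)) volume := hw.1.ennreal_ofReal
  exact ⟨A, hm.mk _, hA, hm.measurable_mk, hm.ae_eq_mk, h.congr hm.ae_eq_mk⟩

theorem LocallyIntegrableOn.exists_measurable
    (hf : LocallyIntegrableOn f Ω volume) :
    ∃ f' : EuclideanSpace ℝ (Fin d) → ℝ, Measurable f' ∧ f =ᵐ[volume.restrict Ω] f' ∧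
      LocallyIntegrableOn f' Ω volume := by
  have hm := hf.aestronglyMeasurable
  refine ⟨hm.mk f, hm.stronglyMeasurable_mk.measurable, hm.ae_eq_mk,
    hf.congr hm.ae_eq_mk⟩

theorem frontier_nonempty_of_isBounded {E : Type*} [NormedAddCommGroup E] [NormedSpace ℝ E]
    [FiniteDimensional ℝ E] [Nontrivial E] {s : Set E} (hs : s.Nonempty)
    (hb : Bornology.IsBounded s) : (frontier s).Nonempty := by
  refine nonempty_frontier_iff.2 ⟨hs, ?_⟩
  rintro rfl
  have := NormedSpace.noncompactSpace ℝ E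
  have := FiniteDimensional.proper_real E
  exact noncompact_univ E (isCompact_of_isClosed_isBounded isClosed_univ hb)

end Energy

/-! ### The main theorem -/

theorem theorem4p1 {d : ℕ} (Ω : Set (EuclideanSpace ℝ (Fin d)))
    (hΩne : Ω.Nonempty) (hΩb : Bornology.IsBounded Ω) (hΩ : IsUniformDomain Ω)
    (s θ : ℝ) (hs0 : 0 < s) (hs1 : s < 1) (hθ0 : 0 < θ) (hθ1 : θ ≤ 1)
    (w v : EuclideanSpace ℝ (Fin d) → ℝ) (hw : IsMuckenhouptA1 w) (hv : IsMuckenhouptA1 v) :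
    ∃ C : ℝ, 0 < C ∧ ∀ f : EuclideanSpace ℝ (Fin d) → ℝ, LocallyIntegrableOn f Ω volume →
      gagliardoSeminorm s 1 w v Ω f ≤ ENNReal.ofReal C * truncatedSeminorm s θ w v Ω f ∧
      truncatedSeminorm s θ w v Ω f ≤ ENNReal.ofReal C * gagliardoSeminorm s 1 w v Ω f := by
  -- In dimension zero the frontier is empty and the curve argument is unavailable, but every `f` is
  -- constant and both seminorms vanish.
  rcases subsingleton_or_nontrivial (EuclideanSpace ℝ (Fin d)) with hE | hE
  · have h0 : ∀ (f : EuclideanSpace ℝ (Fin d) → ℝ) x y, f x = f y := fun f x y => by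
      rw [Subsingleton.elim x y]
    refine ⟨1, one_pos, fun f _ => ?_⟩
    have hg : gagliardoSeminorm s 1 w v Ω f = 0 := by
      simp [gagliardoSeminorm, h0 f _ 0]
    have ht : truncatedSeminorm s θ w v Ω f = 0 := by
      simp [truncatedSeminorm, h0 f _ 0]
    simp [hg, ht]
  have hΩo := hΩ.1
  obtain ⟨K, hK, hcurves⟩ :=
    hΩ.exists_hasUniformCurves (frontier_nonempty_of_isBounded hΩne hΩb)
  obtain ⟨A, W, hA, hWm, hwW, hW⟩ := hw.exists_measurable
  obtain ⟨B, V, hB, hVm, hvV, hV⟩ := hv.exists_measurable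
  obtain ⟨C, hC, hle⟩ := exists_fullEnergy_le hs0 hθ0 hθ1 hΩo hK hcurves hA hB hWm hVm hW hV
  -- The summand `2` serves the converse bound, where each of the two truncated energies is at most
  -- the full one.
  refine ⟨C.toReal + 2, by positivity, fun f hf => ?_⟩
  obtain ⟨f', hf'm, hff', hf'⟩ := LocallyIntegrableOn.exists_measurable hf
  rw [gagliardoSeminorm_one_eq hff' hw.2.1 hwW hvV,
    truncatedSeminorm_eq hΩo hθ1 hff' hw.2.1 hv.2.1 hwW hvV hf'm hWm hVm,
    ENNReal.ofReal_add ENNReal.toReal_nonneg zero_le_two, ENNReal.ofReal_toReal hC]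
  constructor
  · refine (hle f' hf'm hf').trans ?_
    gcongr
    exact le_self_add
  · calc _ ≤ fullEnergy s Ω f' W V + fullEnergy s Ω f' V W :=
          add_le_add (truncEnergy_le_fullEnergy hΩo hθ1) (truncEnergy_le_fullEnergy hΩo hθ1)
      _ = ENNReal.ofReal 2 * fullEnergy s Ω f' W V := by
          rw [fullEnergy_swap hf'm hVm hWm, ENNReal.ofReal_ofNat, two_mul]
      _ ≤ _ := by
          gcongr
          exact le_add_self
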